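/- Let $d\in\mathbb{N}^+$, $B_0>0$ and $\beta=s+r>0$ with $s\in\mathbb{N}_0$ and $r\in(0,1]$; write $\lfloor\beta\rfloor:=s$, so that $\lfloor\beta\rfloor$ is the largest integer strictly smaller than $\beta$. Let $\mathcal{H}^\beta([0,1]^d,B_0)$ be the set of functions $f:[0,1]^d\to\mathbb{R}$ whose partial derivatives $\partial^\alpha f$, $\alpha\in\mathbb{N}_0^d$, $\|\alpha\|_1\le s$, exist on $[0,1]^d$ (one-sided on the boundary) and satisfy $$\max_{\|\alpha\|_1\le s}\|\partial^\alpha f\|_\infty\le B_0,\qquad \max_{\|\alpha\|_1=s}\ \sup_{x\ne y}\frac{|\partial^\alpha f(x)-\partial^\alpha f(y)|}{\|x-y\|_2^{r}}\le B_0 .$$ A ReLU network of depth $\mathcal{D}$ and width $\mathcal{W}$ is a function $\mathcal{L}_{\mathcal{D}}\circ\sigma\circ\mathcal{L}_{\mathcal{D}-1}\circ\cdots\circ\sigma\circ\mathcal{L}_0:\mathbb{R}^d\to\mathbb{R}$ with affine maps $\mathcal{L}_i:\mathbb{R}^{p_i}\to\mathbb{R}^{p_{i+1}}$, $p_0=d$,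 $p_{\mathcal{D}+1}=1$, the coordinatewise activation $\sigma(t)=\max(0,t)$, and $\mathcal{W}=\max\{p_1,\dots,p_{\mathcal{D}}\}$. For $K\in\mathbb{N}^+$ and $\delta>0$ put $$\Omega([0,1]^d,K,\delta)=\bigcup_{i=1}^d\Big\{x=(x_1,\dots,x_d):\ x_i\in\bigcup_{k=1}^{K-1}\big(k/K-\delta,\ k/K\big)\Big\}.$$ Let $f\in\mathcal{H}^\beta([0,1]^d,B_0)$ and $N,M\in\mathbb{N}^+$, put $K=\lceil (MN)^{2/d}\rceil$, and let $\delta\in(0,1/(3K)]$ be arbitrary. Then there is a function $\phi_0$ implemented by a ReLU network of width $\mathcal{W}=38(\lfloor\beta\rfloor+1)^2d^{\lfloor\beta\rfloor+1}N\lceil\log_2(8N)\rceil$ and depth $\mathcal{D}=21(\lfloor\beta\rfloor+1)^2M\lceil\log_2(8M)\rceil$ such that $$|f(x)-\phi_0(x)|\le 18B_0(\lfloor\beta\rfloor+1)^2d^{\lfloor\beta\rfloor+\max\{\beta,1\}/2}(NM)^{-2\beta/d}\qquad\text{for all }x\in[0,1]^d\setminus\Omega([0,1]^d,K,\delta).$$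 -/

import Mathlib

/-- Fully connected feedforward ReLU networks from `ℝ^m` to `ℝ^n`: either a single affine map,
or a hidden layer (an affine map followed by the coordinatewise ReLU) followed by a network. -/
inductive ReLUNet : ℕ → ℕ → Type
  | affine {m n : ℕ} (W : Matrix (Fin n) (Fin m) ℝ) (b : Fin n → ℝ) : ReLUNet m n
  | layer {m k n : ℕ} (W : Matrix (Fin k) (Fin m) ℝ) (b : Fin k → ℝ) (rest : ReLUNet k n) :
      ReLUNet m n

namespace ReLUNet

/-- The function `ℝ^m → ℝ^n` implemented by the network. -/
noncomputable def eval : {m n : ℕ} → ReLUNet m n → (Fin m → ℝ) → (Fin n → ℝ)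
  | _, _, affine W b, x => W.mulVec x + b
  | _, _, layer W b rest, x => rest.eval (fun i => max 0 ((W.mulVec x + b) i))

/-- The depth: the number of hidden layers. -/
def depth : {m n : ℕ} → ReLUNet m n → ℕ
  | _, _, affine _ _ => 0
  | _, _, layer _ _ rest => rest.depth + 1

/-- The width: the maximal number of neurons in a hidden layer. -/
def width : {m n : ℕ} → ReLUNet m n → ℕ
  | _, _, affine _ _ => 0
  | _, _, layer (k := k) _ _ rest => max k rest.width

end ReLUNet

/-- The closed unit cube `[0,1]^d`. -/
def unitCube (d : ℕ) : Set (EuclideanSpace ℝ (Fin d)) :=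
  {x | ∀ i, x i ∈ Set.Icc (0 : ℝ) 1}

/-- The Hölder class `H^β([0,1]^d, B₀)` with `β = s + r`, `s ∈ ℕ`, `r ∈ (0,1]`. Only the values of
`f` on the cube matter. `D α` is the partial derivative `∂^α f` on the cube, for `|α| ≤ s` (one-sided
on the faces): `∂^0 f = f`, and `∂^(α + e_i) f` is the partial derivative of `∂^α f` in the `i`-th
coordinate. These requirements determine `D α` on the cube uniquely. -/
def HolderClass (d s : ℕ) (r B₀ : ℝ) (f : EuclideanSpace ℝ (Fin d) → ℝ) : Prop :=
  ∃ D : (Fin d → ℕ) → EuclideanSpace ℝ (Fin d) → ℝ,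
    (∀ x ∈ unitCube d, D 0 x = f x) ∧
    (∀ α : Fin d → ℕ, ∑ j, α j < s → ∀ i : Fin d, ∀ x ∈ unitCube d,
      HasLineDerivWithinAt ℝ (D α) (D (α + Pi.single i 1) x) (unitCube d) x
        (EuclideanSpace.single i (1 : ℝ))) ∧
    (∀ α : Fin d → ℕ, ∑ j, α j ≤ s → ∀ x ∈ unitCube d, |D α x| ≤ B₀) ∧
    (∀ α : Fin d → ℕ, ∑ j, α j = s → ∀ x ∈ unitCube d, ∀ y ∈ unitCube d,
      |D α x - D α y| ≤ B₀ * ‖x - y‖ ^ r)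

/-- The trifling region `Ω([0,1]^d, K, δ)`: some coordinate lies in an interval
`(k/K - δ, k/K)` with `1 ≤ k ≤ K - 1`. -/
def triflingRegion (d K : ℕ) (δ : ℝ) : Set (EuclideanSpace ℝ (Fin d)) :=
  {x | ∃ i : Fin d, ∃ k : ℕ, 1 ≤ k ∧ k < K ∧ x i ∈ Set.Ioo ((k : ℝ) / K - δ) ((k : ℝ) / K)}

/-!
On each cell of a grid of mesh `2 / K` the Taylor polynomial of `f` at the center of the cell
approximates `f` up to the Hölder remainder. Off the trifling region a piecewise linear function can
determine the cell containing `x`, digit by digit, in a positional system that has the base `N` once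
or twice and the base `2` otherwise: width `O(N)` and depth `O(log M)` suffice. There are at most
`(N M)^2` cells, so a Taylor coefficient is a table with indices `(p, q, t, l)`, where `p, q < N`
and `t, l < M`. The entries for fixed `(p, q, t)` are rounded and packed into the digits of one
weight; the layers run through `t`, `N` neurons select the weight belonging to `(p, q)`, and
stripping leading digits reveals the entry `l`. Finally, monomials are multiplied out by
polarisation of the square, whose piecewise linear interpolants are refined geometrically by
composition with zigzags.
-/

/-! ### Networks with labelled outputs -/

namespace ReLUNet

/-- The network `φ` followed by a ReLU activation of its outputs and an affine map. -/
def snoc : {m n k : ℕ} → ReLUNet m n → Matrix (Fin k) (Fin n) ℝ → (Fin k → ℝ) → ReLUNet m k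
  | _, _, _, affine W₀ b₀, W, b => layer W₀ b₀ (affine W b)
  | _, _, _, layer W₀ b₀ rest, W, b => layer W₀ b₀ (rest.snoc W b)

variable {m n k : ℕ} (φ : ReLUNet m n) (W : Matrix (Fin k) (Fin n) ℝ) (b : Fin k → ℝ)

theorem eval_snoc (x : Fin m → ℝ) :
    (φ.snoc W b).eval x = W.mulVec (fun i => max 0 (φ.eval x i)) + b := by
  induction φ with
  | affine W₀ b₀ => simp [snoc, eval]
  | layer W₀ b₀ _ ih => exact ih W _

theorem depth_snoc : (φ.snoc W b).depth = φ.depth + 1 := by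
  induction φ with
  | affine W₀ b₀ => simp [snoc, depth]
  | layer W₀ b₀ _ ih => rw [snoc, depth, ih, depth]

theorem width_snoc : (φ.snoc W b).width = max φ.width n := by
  induction φ with
  | affine W₀ b₀ => simp [snoc, width]
  | layer W₀ b₀ _ ih => rw [snoc, width, ih, width, max_assoc]

end ReLUNet

/-- Real-valued affine functions on a real vector space, as a predicate on unbundled functions: the
weights of a network are then never written down. -/
def IsAffine {V : Type*} [AddCommGroup V] [Module ℝ V] (f : V → ℝ) : Prop :=
  ∃ g : V →ᵃ[ℝ] ℝ, ⇑g = f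

namespace IsAffine

variable {V : Type*} [AddCommGroup V] [Module ℝ V] {f g : V → ℝ}

theorem const (a : ℝ) : IsAffine (fun _ : V => a) := ⟨AffineMap.const ℝ V a, rfl⟩

theorem coord {ι : Type*} (i : ι) : IsAffine (fun v : ι → ℝ => v i) := ⟨AffineMap.proj i, rfl⟩

theorem add (hf : IsAffine f) (hg : IsAffine g) : IsAffine (fun v => f v + g v) := by
  obtain ⟨f, rfl⟩ := hf
  obtain ⟨g, rfl⟩ := hg
  exact ⟨f + g, rfl⟩

theorem const_mul (a : ℝ) (hf : IsAffine f) : IsAffine (fun v => a * f v) := by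
  obtain ⟨f, rfl⟩ := hf
  exact ⟨a • f, rfl⟩

theorem mul_const (a : ℝ) (hf : IsAffine f) : IsAffine (fun v => f v * a) := by
  simpa only [mul_comm] using hf.const_mul a

theorem div_const (a : ℝ) (hf : IsAffine f) : IsAffine (fun v => f v / a) := by
  simpa only [div_eq_mul_inv] using hf.mul_const a⁻¹

theorem neg (hf : IsAffine f) : IsAffine (fun v => -f v) := by
  obtain ⟨f, rfl⟩ := hf
  exact ⟨-f, rfl⟩

theorem sub (hf : IsAffine f) (hg : IsAffine g) : IsAffine (fun v => f v - g v) := by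
  obtain ⟨f, rfl⟩ := hf
  obtain ⟨g, rfl⟩ := hg
  exact ⟨f - g, rfl⟩

theorem sum {τ : Type*} (s : Finset τ) {F : τ → V → ℝ} (h : ∀ t, IsAffine (F t)) :
    IsAffine (fun v => ∑ t ∈ s, F t v) := by
  choose G hG using h
  refine ⟨∑ t ∈ s, G t, ?_⟩
  funext v
  simp only [← hG]
  exact map_sum (AddMonoidHom.mk' (fun A : V →ᵃ[ℝ] ℝ => A v) fun _ _ => rfl) G s

theorem comp {κ : Type*} {g : (κ → ℝ) → ℝ} (hg : IsAffine g) {F : κ → V → ℝ}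
    (hF : ∀ k, IsAffine (F k)) : IsAffine (fun v => g (fun k => F k v)) := by
  obtain ⟨g, rfl⟩ := hg
  choose G hG using hF
  refine ⟨g.comp (AffineMap.pi G), ?_⟩
  funext v
  simp only [← hG]
  rfl

theorem exists_eq_sum_add {ι : Type*} [Fintype ι] {f : (ι → ℝ) → ℝ} (hf : IsAffine f) :
    ∃ (c : ι → ℝ) (b : ℝ), ∀ v, f v = ∑ i, c i * v i + b := by
  classical
  obtain ⟨f, rfl⟩ := hf
  refine ⟨fun i => f.linear (fun j => if i = j then 1 else 0), f 0, fun v => ?_⟩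
  rw [congrFun f.decomp v, Pi.add_apply, LinearMap.pi_apply_eq_sum_univ f.linear v]
  simp only [smul_eq_mul, mul_comm]

end IsAffine

/-- Functions computed by one hidden layer of `n` ReLU neurons, with affine output. -/
def IsShallow {V : Type*} [AddCommGroup V] [Module ℝ V] (n : ℕ) (f : V → ℝ) : Prop :=
  ∃ (a : Fin n → V → ℝ) (g : (Fin n → ℝ) → ℝ), (∀ j, IsAffine (a j)) ∧ IsAffine g ∧
    ∀ v, f v = g (fun j => max 0 (a j v))

namespace IsShallow

variable {V : Type*} [AddCommGroup V] [Module ℝ V] {f g : V → ℝ} {n n' : ℕ}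

theorem const (a : ℝ) : IsShallow n (fun _ : V => a) :=
  ⟨fun _ _ => 0, fun _ => a, fun _ => .const 0, .const a, fun _ => rfl⟩

theorem relu (hf : IsAffine f) : IsShallow 1 (fun v => max 0 (f v)) :=
  ⟨fun _ => f, fun u => u 0, fun _ => hf, .coord 0, fun _ => rfl⟩

theorem add (hf : IsShallow n f) (hg : IsShallow n' g) :
    IsShallow (n + n') (fun v => f v + g v) := by
  obtain ⟨a, A, ha, hA, hf⟩ := hf
  obtain ⟨b, B, hb, hB, hg⟩ := hg
  refine ⟨Fin.append a b, fun u => A (fun j => u (Fin.castAdd n' j)) +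
    B (fun j => u (Fin.natAdd n j)), fun j => ?_,
    (hA.comp fun j => .coord _).add (hB.comp fun j => .coord _), fun v => ?_⟩
  · induction j using Fin.addCases with
    | left i => simpa only [Fin.append_left] using ha i
    | right i => simpa only [Fin.append_right] using hb i
  · simp only [hf, hg, Fin.append_left, Fin.append_right]

theorem const_mul (a : ℝ) (hf : IsShallow n f) : IsShallow n (fun v => a * f v) := by
  obtain ⟨b, B, hb, hB, h⟩ := hf
  exact ⟨b, fun u => a * B u, hb, hB.const_mul a, fun v => by simp only [h]⟩

theorem sub (hf : IsShallow n f) (hg : IsShallow n' g) :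
    IsShallow (n + n') (fun v => f v - g v) := by
  simpa only [neg_one_mul, ← sub_eq_add_neg] using hf.add (hg.const_mul (-1))

theorem of_affine (hf : IsAffine f) : IsShallow 2 f := by
  have h := (relu hf).sub (relu hf.neg)
  simpa only [max_comm (0 : ℝ), max_zero_sub_max_neg_zero_eq_self] using h

theorem coord {ι : Type*} (i : ι) : IsShallow 2 (fun v : ι → ℝ => v i) := of_affine (.coord i)

theorem mono (hf : IsShallow n f) (h : n ≤ n') : IsShallow n' f := by
  obtain ⟨k, rfl⟩ := Nat.exists_eq_add_of_le h
  simpa only [add_zero] using hf.add (const (n := k) 0)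

theorem sum {τ : Type*} (s : Finset τ) {F : τ → V → ℝ} (h : ∀ t, IsShallow n (F t)) :
    IsShallow (s.card * n) (fun v => ∑ t ∈ s, F t v) := by
  classical
  induction s using Finset.induction_on with
  | empty => simpa using const 0
  | insert a s ha ih =>
    simp only [Finset.sum_insert ha, Finset.card_insert_of_notMem ha, add_mul, one_mul]
    rw [add_comm]
    exact (h a).add ih

end IsShallow

/-- `Computes S w D F`: on the set `S`, the function `F` agrees with a ReLU network having `D`
hidden layers of exactly `w` neurons each. The outputs are indexed by an arbitrary type, so that
the state of a partially built network can carry meaningful labels. -/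
def Computes {m : ℕ} (S : Set (Fin m → ℝ)) (w : ℕ) :
    ℕ → {κ : Type} → ((Fin m → ℝ) → κ → ℝ) → Prop
  | 0, _, F => ∀ k, ∃ f, IsAffine f ∧ ∀ x ∈ S, F x k = f x
  | D + 1, _, F => ∃ G : (Fin m → ℝ) → Fin w → ℝ, Computes S w D G ∧
      ∀ k, ∃ f, IsAffine f ∧ ∀ x ∈ S, F x k = f (fun j => max 0 (G x j))

namespace Computes

variable {m : ℕ} {S : Set (Fin m → ℝ)} {w w' D D' : ℕ} {κ κ' : Type}
  {F : (Fin m → ℝ) → κ → ℝ} {F' : (Fin m → ℝ) → κ' → ℝ}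

theorem input : Computes S w 0 (fun x => x) := fun k => ⟨_, .coord k, fun _ _ => rfl⟩

theorem affine (hF : Computes S w D F)
    (h : ∀ k, ∃ g, IsAffine g ∧ ∀ x ∈ S, F' x k = g (F x)) : Computes S w D F' := by
  choose g hg hF' using h
  cases D with
  | zero =>
    choose f hf hF using hF
    exact fun k => ⟨_, (hg k).comp hf, fun x hx => by
      rw [hF' k x hx]; exact congrArg _ (funext fun j => hF j x hx)⟩
  | succ D =>
    obtain ⟨G, hG, hF⟩ := hF
    choose f hf hF using hF
    exact ⟨G, hG, fun k => ⟨_, (hg k).comp hf, fun x hx => by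
      rw [hF' k x hx]; exact congrArg _ (funext fun j => hF j x hx)⟩⟩

theorem congr (hF : Computes S w D F) {F₁ : (Fin m → ℝ) → κ → ℝ}
    (h : ∀ x ∈ S, ∀ k, F₁ x k = F x k) : Computes S w D F₁ :=
  hF.affine fun k => ⟨_, .coord k, fun x hx => h x hx k⟩

theorem layer {H : Type} [Fintype H] {G : (Fin m → ℝ) → H → ℝ} (hG : Computes S w D G)
    (hH : Fintype.card H ≤ w)
    (h : ∀ k, ∃ f, IsAffine f ∧ ∀ x ∈ S, F x k = f (fun j => max 0 (G x j))) :
    Computes S w (D + 1) F := by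
  classical
  obtain ⟨e⟩ : Nonempty (H ↪ Fin w) :=
    Function.Embedding.nonempty_of_card_le (by simpa using hH)
  refine ⟨fun x => Function.extend e (G x) 0, hG.affine fun j => ?_, fun k => ?_⟩
  · by_cases hj : ∃ a, e a = j
    · obtain ⟨a, rfl⟩ := hj
      exact ⟨_, .coord a, fun x _ => e.injective.extend_apply _ _ _⟩
    · exact ⟨_, .const 0, fun x _ => Function.extend_apply' _ _ _ hj⟩
  · obtain ⟨f, hf, hF⟩ := h k
    refine ⟨fun u => f (fun a => u (e a)), hf.comp fun a => .coord _, fun x hx => ?_⟩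
    simp only [hF x hx, e.injective.extend_apply]

theorem step [Fintype κ'] (hF : Computes S w D F) (n : κ' → ℕ) (hn : ∑ k, n k ≤ w)
    (h : ∀ k, ∃ g, IsShallow (n k) g ∧ ∀ x ∈ S, F' x k = g (F x)) :
    Computes S w (D + 1) F' := by
  choose g hg hF' using h
  choose a A ha hA hgA using hg
  exact layer (H := Σ k, Fin (n k)) (G := fun x j => a j.1 j.2 (F x))
    (hF.affine fun j => ⟨_, ha j.1 j.2, fun _ _ => rfl⟩) (by simpa using hn) fun k =>
      ⟨fun u => A k (fun j => u ⟨k, j⟩), (hA k).comp fun j => .coord _, fun x hx => by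
        rw [hF' k x hx, hgA]⟩

theorem affine_inr {C : (Fin m → ℝ) → κ → ℝ} {τ τ' : Type} {F : (Fin m → ℝ) → τ → ℝ}
    {F' : (Fin m → ℝ) → τ' → ℝ} (hF : Computes S w D (fun x => Sum.elim (C x) (F x)))
    (h : ∀ t, ∃ g, IsAffine g ∧ ∀ x ∈ S, F' x t = g (Sum.elim (C x) (F x))) :
    Computes S w D (fun x => Sum.elim (C x) (F' x)) :=
  hF.affine (Sum.rec (fun k => ⟨_, .coord (.inl k), fun _ _ => rfl⟩) h)

theorem step_inr [Fintype κ] {C : (Fin m → ℝ) → κ → ℝ} {τ τ' : Type} [Fintype τ']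
    {F : (Fin m → ℝ) → τ → ℝ} {F' : (Fin m → ℝ) → τ' → ℝ}
    (hF : Computes S w D (fun x => Sum.elim (C x) (F x))) (n : τ' → ℕ)
    (hn : Fintype.card κ * 2 + ∑ t, n t ≤ w)
    (h : ∀ t, ∃ g, IsShallow (n t) g ∧ ∀ x ∈ S, F' x t = g (Sum.elim (C x) (F x))) :
    Computes S w (D + 1) (fun x => Sum.elim (C x) (F' x)) :=
  hF.step (Sum.elim (fun _ => 2) n) (by simpa using hn)
    (Sum.rec (fun k => ⟨_, .coord (.inl k), fun _ _ => rfl⟩) h)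

theorem mono_width (hF : Computes S w D F) (h : w ≤ w') : Computes S w' D F := by
  induction D generalizing κ with
  | zero => exact hF
  | succ D ih =>
    obtain ⟨G, hG, hF⟩ := hF
    exact layer (ih hG) (by simpa using h) hF

theorem mono_depth [Fintype κ] (hF : Computes S w D F) (hw : Fintype.card κ * 2 ≤ w)
    (h : D ≤ D') : Computes S w D' F := by
  induction D', h using Nat.le_induction with
  | base => exact hF
  | succ D' _ ih =>
    exact ih.step (fun _ => 2) (by simpa using hw) fun j => ⟨_, .coord j, fun _ _ => rfl⟩

theorem sumElim (hF : Computes S w D F) (hF' : Computes S w' D F') :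
    Computes S (w + w') D (fun x => Sum.elim (F x) (F' x)) := by
  induction D generalizing κ κ' with
  | zero => exact Sum.rec hF hF'
  | succ D ih =>
    obtain ⟨G, hG, hF⟩ := hF
    obtain ⟨G', hG', hF'⟩ := hF'
    refine layer (ih hG hG') (by simp) ?_
    rintro (k | k)
    · obtain ⟨f, hf, hF⟩ := hF k
      exact ⟨fun u => f (fun j => u (.inl j)), hf.comp fun j => .coord _, hF⟩
    · obtain ⟨f, hf, hF'⟩ := hF' k
      exact ⟨fun u => f (fun j => u (.inr j)), hf.comp fun j => .coord _, hF'⟩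

theorem zero : Computes S w D (fun _ (_ : κ) => 0) := by
  induction D generalizing κ with
  | zero => exact fun k => ⟨_, .const 0, fun _ _ => rfl⟩
  | succ D ih => exact ⟨_, ih, fun k => ⟨_, .const 0, fun _ _ => rfl⟩⟩

theorem sum {τ : Type*} (s : Finset τ) {f : τ → (Fin m → ℝ) → ℝ}
    (h : ∀ t, Computes S w D (fun x (_ : Unit) => f t x)) :
    Computes S (s.card * w) D (fun x (_ : Unit) => ∑ t ∈ s, f t x) := by
  classical
  induction s using Finset.induction_on with
  | empty => simpa using zero
  | insert a s ha ih =>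
    simp only [Finset.sum_insert ha, Finset.card_insert_of_notMem ha, add_mul, one_mul]
    rw [add_comm]
    exact ((h a).sumElim ih).affine fun _ =>
      ⟨_, (IsAffine.coord (.inl ())).add (.coord (.inr ())), fun x _ => rfl⟩

theorem exists_net {n : ℕ} {F : (Fin m → ℝ) → Fin n → ℝ} (hF : Computes S w D F) :
    ∃ φ : ReLUNet m n, φ.width = (if D = 0 then 0 else w) ∧ φ.depth = D ∧
      ∀ x ∈ S, φ.eval x = F x := by
  induction D generalizing n with
  | zero =>
    choose f hf hF using hF
    choose c b hcb using fun k => (hf k).exists_eq_sum_add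
    refine ⟨.affine (Matrix.of c) b, rfl, rfl, fun x hx => funext fun k => ?_⟩
    rw [hF k x hx, hcb]
    simp [ReLUNet.eval, Matrix.mulVec, dotProduct]
  | succ D ih =>
    obtain ⟨G, hG, hF⟩ := hF
    obtain ⟨φ, hwidth, hdepth, hφ⟩ := ih hG
    choose f hf hF using hF
    choose c b hcb using fun k => (hf k).exists_eq_sum_add
    refine ⟨φ.snoc (Matrix.of c) b, ?_, ?_, fun x hx => funext fun k => ?_⟩
    · rw [ReLUNet.width_snoc, hwidth]; split_ifs <;> simp_all
    · rw [ReLUNet.depth_snoc, hdepth]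
    · rw [ReLUNet.eval_snoc, hF k x hx, hcb, hφ x hx]
      simp [Matrix.mulVec, dotProduct]

end Computes

/-! ### Digits and products -/

/-- A continuous substitute for the indicator of `[0, ∞)`, exact outside `(-δ, 0)`. -/
noncomputable def ramp (δ z : ℝ) : ℝ := max 0 (z / δ + 1) - max 0 (z / δ)

theorem ramp_of_nonneg {δ z : ℝ} (hδ : 0 < δ) (hz : 0 ≤ z) : ramp δ z = 1 := by
  have hz' := div_nonneg hz hδ.le
  rw [ramp, max_eq_right (by linarith), max_eq_right hz', add_sub_cancel_left]

theorem ramp_of_le {δ z : ℝ} (hδ : 0 < δ) (hz : z ≤ -δ) : ramp δ z = 0 := by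
  have hz' : z / δ ≤ -1 := by rw [div_le_iff₀ hδ]; linarith
  rw [ramp, max_eq_left (by linarith), max_eq_left (by linarith), sub_self]

theorem ramp_natCast_add_sub {δ f : ℝ} (hδ : 0 < δ) (hf0 : 0 ≤ f) (hf1 : f ≤ 1 - δ) (k t : ℕ) :
    ramp δ (k + f - t) = if t ≤ k then 1 else 0 := by
  split_ifs with h
  · have : (t : ℝ) ≤ k := by exact_mod_cast h
    exact ramp_of_nonneg hδ (by linarith)
  · have : (k : ℝ) + 1 ≤ t := by exact_mod_cast not_le.mp h
    exact ramp_of_le hδ (by linarith)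

theorem IsShallow.ramp {V : Type*} [AddCommGroup V] [Module ℝ V] {f : V → ℝ} (δ : ℝ)
    (hf : IsAffine f) : IsShallow 2 (fun v => ramp δ (f v)) :=
  (relu ((hf.div_const δ).add (.const 1))).sub (.relu (hf.div_const δ))

/-- Removes the leading base-`b` digit, of weight `R`, from `z`. -/
noncomputable def stripDigit (b : ℕ) (R δ z : ℝ) : ℝ :=
  z - R * ∑ i ∈ Finset.range (b - 1), ramp δ (z - (i + 1) * R)

theorem IsShallow.stripDigit {V : Type*} [AddCommGroup V] [Module ℝ V] {f : V → ℝ} {b : ℕ}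
    (hb : 1 ≤ b) (R δ : ℝ) (hf : IsAffine f) :
    IsShallow (2 * b) (fun v => stripDigit b R δ (f v)) := by
  have hsum := IsShallow.sum (Finset.range (b - 1)) fun i =>
    IsShallow.ramp δ (hf.sub (.const ((i + 1) * R)))
  refine ((of_affine hf).sub (hsum.const_mul R)).mono ?_
  rw [Finset.card_range]
  lia

theorem sum_ramp_eq_div {k b R : ℕ} (hR : 1 ≤ R) (hk : k < b * R) {f δ : ℝ} (hδ : 0 < δ)
    (hf0 : 0 ≤ f) (hf1 : f ≤ 1 - δ) :
    ∑ i ∈ Finset.range (b - 1), ramp δ (k + f - (i + 1) * R) = (k / R : ℕ) := by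
  have hterm (i : ℕ) : ramp δ (k + f - (i + 1) * R) = if i < k / R then 1 else 0 := by
    have := ramp_natCast_add_sub hδ hf0 hf1 k ((i + 1) * R)
    push_cast at this
    simp only [this, ← Nat.le_div_iff_mul_le hR, Nat.succ_le_iff]
  have hquot : k / R < b := Nat.div_lt_of_lt_mul (by rwa [mul_comm])
  have hfilter : {i ∈ Finset.range (b - 1) | i < k / R} = Finset.range (k / R) := by
    ext i
    simp only [Finset.mem_filter, Finset.mem_range]
    lia
  rw [Finset.sum_congr rfl fun i _ => hterm i, Finset.sum_boole, hfilter, Finset.card_range]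

theorem stripDigit_mod_mul {n b R : ℕ} (hb : 1 ≤ b) (hR : 1 ≤ R) {f δ : ℝ} (hδ : 0 < δ)
    (hf0 : 0 ≤ f) (hf1 : f ≤ 1 - δ) :
    stripDigit b R δ ((n % (b * R) : ℕ) + f) = (n % R : ℕ) + f := by
  have hlt : n % (b * R) < b * R := Nat.mod_lt _ (Nat.mul_pos hb hR)
  have hdiv : ((n % (b * R) % R : ℕ) : ℝ) + R * (n % (b * R) / R : ℕ) = (n % (b * R) : ℕ) := by
    exact_mod_cast Nat.mod_add_div _ R
  rw [stripDigit, sum_ramp_eq_div hR hlt hδ hf0 hf1, ← hdiv, Nat.mod_mul_left_mod]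
  ring

/-- The zigzag function with `b` monotone pieces on `[0,1]`. -/
noncomputable def zigzag (b : ℕ) (x : ℝ) : ℝ :=
  max 0 (b * x) + 2 * ∑ k ∈ Finset.range (b - 1), (-1) ^ (k + 1) * max 0 (b * x - (k + 1))

/-- The piecewise linear interpolant of `x - x ^ 2` on `[0,1]` with nodes `k / b`. -/
noncomputable def parabolaInterp (b : ℕ) (x : ℝ) : ℝ :=
  (1 - 1 / b) * max 0 x - 2 / (b * b) * ∑ k ∈ Finset.range (b - 1), max 0 (b * x - (k + 1))

section Shallow

variable {V : Type*} [AddCommGroup V] [Module ℝ V] {f : V → ℝ} {b : ℕ}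

theorem IsShallow.zigzag (hb : 1 ≤ b) (hf : IsAffine f) :
    IsShallow b (fun v => zigzag b (f v)) := by
  have hsum := IsShallow.sum (Finset.range (b - 1)) fun k =>
    (relu ((hf.const_mul b).sub (.const (k + 1)))).const_mul ((-1) ^ (k + 1))
  refine ((relu (hf.const_mul b)).add (hsum.const_mul 2)).mono ?_
  rw [Finset.card_range]
  lia

theorem IsShallow.parabolaInterp (hb : 1 ≤ b) (hf : IsAffine f) :
    IsShallow b (fun v => parabolaInterp b (f v)) := by
  have hsum := IsShallow.sum (Finset.range (b - 1)) fun k =>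
    relu ((hf.const_mul b).sub (.const (k + 1)))
  refine (((relu hf).const_mul (1 - 1 / b)).sub (hsum.const_mul (2 / (b * b)))).mono ?_
  rw [Finset.card_range]
  lia

end Shallow

theorem sum_range_mul_relu {n m : ℕ} (hmn : m ≤ n) (c : ℕ → ℝ) {y : ℝ} (h0 : m ≤ y)
    (h1 : y ≤ m + 1) :
    ∑ k ∈ Finset.range n, c k * max 0 (y - (k + 1)) =
      ∑ k ∈ Finset.range m, c k * (y - (k + 1)) := by
  have htail : ∑ k ∈ Finset.Ico m n, c k * max 0 (y - (k + 1)) = 0 := by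
    refine Finset.sum_eq_zero fun k hk => ?_
    have : (m : ℝ) ≤ k := by exact_mod_cast (Finset.mem_Ico.mp hk).1
    rw [max_eq_left (by linarith), mul_zero]
  rw [← Finset.sum_range_add_sum_Ico _ hmn, htail, add_zero]
  refine Finset.sum_congr rfl fun k hk => ?_
  have : (k : ℝ) + 1 ≤ m := by exact_mod_cast Finset.mem_range.mp hk
  rw [max_eq_right (by linarith)]

theorem add_two_mul_sum_range_alternating (m : ℕ) (y : ℝ) :
    y + 2 * ∑ k ∈ Finset.range m, (-1) ^ (k + 1) * (y - (k + 1)) =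
      if Even m then y - m else m + 1 - y := by
  induction m with
  | zero => simp
  | succ m ih =>
    rw [Finset.sum_range_succ, mul_add, ← add_assoc, ih, Nat.cast_succ]
    by_cases h : Even m
    · rw [if_pos h, if_neg (by simpa [Nat.even_add_one] using h), h.add_one.neg_one_pow]
      ring
    · rw [if_neg h, if_pos (Nat.even_add_one.mpr h), (Nat.even_add_one.mpr h).neg_one_pow]
      ring

theorem sum_range_sub_succ (m : ℕ) (y : ℝ) :
    ∑ k ∈ Finset.range m, (y - (k + 1)) = m * y - m * (m + 1) / 2 := by
  induction m with
  | zero => simp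
  | succ m ih => rw [Finset.sum_range_succ, ih]; push_cast; ring

theorem exists_natCast_le_le_add_one {b : ℕ} (hb : 1 ≤ b) {y : ℝ} (h0 : 0 ≤ y) (h1 : y ≤ b) :
    ∃ m : ℕ, m ≤ b - 1 ∧ m ≤ y ∧ y ≤ m + 1 := by
  rcases h1.lt_or_eq with h | rfl
  · exact ⟨⌊y⌋₊, Nat.le_sub_one_of_lt ((Nat.floor_lt h0).mpr h), Nat.floor_le h0,
      (Nat.lt_floor_add_one y).le⟩
  · exact ⟨b - 1, le_rfl, by simp, by simp [Nat.cast_sub hb]⟩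

theorem zigzag_eq {b m : ℕ} (hm : m ≤ b - 1) {x : ℝ} (h0 : m ≤ b * x) (h1 : b * x ≤ m + 1) :
    zigzag b x = if Even m then b * x - m else m + 1 - b * x := by
  rw [zigzag, max_eq_right (m.cast_nonneg.trans h0),
    sum_range_mul_relu hm (fun k => (-1) ^ (k + 1)) h0 h1, add_two_mul_sum_range_alternating]

theorem parabolaInterp_eq {b m : ℕ} (hm : m ≤ b - 1) {x : ℝ} (hx : 0 ≤ x) (h0 : m ≤ b * x)
    (h1 : b * x ≤ m + 1) :
    parabolaInterp b x = (1 - 1 / b) * x - 2 / (b * b) * (m * (b * x) - m * (m + 1) / 2) := by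
  have hsum := sum_range_mul_relu hm (fun _ => 1) h0 h1
  simp only [one_mul, sum_range_sub_succ] at hsum
  rw [parabolaInterp, max_eq_right hx, hsum]

section Parabola

variable {b : ℕ} {x : ℝ}

theorem zigzag_mem_Icc (hb : 1 ≤ b) (hx : x ∈ Set.Icc (0 : ℝ) 1) :
    zigzag b x ∈ Set.Icc (0 : ℝ) 1 := by
  obtain ⟨m, hm, h0, h1⟩ := exists_natCast_le_le_add_one hb (y := b * x)
    (mul_nonneg b.cast_nonneg hx.1) (mul_le_of_le_one_right b.cast_nonneg hx.2)
  rw [zigzag_eq hm h0 h1]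
  split_ifs <;> constructor <;> linarith

/-- The interpolation error of the parabola is a rescaled copy of the parabola on every piece of
the zigzag, which makes the refinement by iteration possible. -/
theorem sub_sq_eq_parabolaInterp_add (hb : 1 ≤ b) (hx : x ∈ Set.Icc (0 : ℝ) 1) :
    x - x ^ 2 = parabolaInterp b x + (zigzag b x - zigzag b x ^ 2) / (b : ℝ) ^ 2 := by
  have : (0 : ℝ) < b := by exact_mod_cast hb
  obtain ⟨m, hm, h0, h1⟩ := exists_natCast_le_le_add_one hb (y := b * x)
    (mul_nonneg b.cast_nonneg hx.1) (mul_le_of_le_one_right b.cast_nonneg hx.2)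
  rw [zigzag_eq hm h0 h1, parabolaInterp_eq hm hx.1 h0 h1]
  split_ifs <;> field

end Parabola

/-- Approximation of `x - x ^ 2` on `[0,1]` by iterated zigzags with numbers of pieces `bs`. -/
noncomputable def parabolaApprox : List ℕ → ℝ → ℝ
  | [], _ => 0
  | b :: bs, x => parabolaInterp b x + parabolaApprox bs (zigzag b x) / (b : ℝ) ^ 2

theorem sub_sq_sub_parabolaApprox_mem_Icc {bs : List ℕ} (hbs : ∀ b ∈ bs, 1 ≤ b) {x : ℝ}
    (hx : x ∈ Set.Icc (0 : ℝ) 1) :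
    x - x ^ 2 - parabolaApprox bs x ∈ Set.Icc 0 (1 / (4 * (bs.prod : ℝ) ^ 2)) := by
  induction bs generalizing x with
  | nil =>
    obtain ⟨h0, h1⟩ := hx
    simp only [parabolaApprox, List.prod_nil, Nat.cast_one]
    constructor <;> nlinarith [sq_nonneg (x - 1 / 2)]
  | cons b bs ih =>
    rw [List.forall_mem_cons] at hbs
    obtain ⟨hnonneg, hle⟩ := ih hbs.2 (zigzag_mem_Icc hbs.1 hx)
    have herr : x - x ^ 2 - parabolaApprox (b :: bs) x =
        (zigzag b x - zigzag b x ^ 2 - parabolaApprox bs (zigzag b x)) / (b : ℝ) ^ 2 := by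
      rw [parabolaApprox, sub_sq_eq_parabolaInterp_add hbs.1 hx]
      ring
    rw [herr]
    refine ⟨by positivity, ?_⟩
    calc (zigzag b x - zigzag b x ^ 2 - parabolaApprox bs (zigzag b x)) / (b : ℝ) ^ 2
        ≤ 1 / (4 * (bs.prod : ℝ) ^ 2) / (b : ℝ) ^ 2 := by gcongr
      _ = 1 / (4 * ((b :: bs).prod : ℝ) ^ 2) := by
        rw [List.prod_cons, Nat.cast_mul, div_div, mul_pow]
        ring_nf

/-- Approximate product of two numbers in `[-1,1]`, by polarisation. -/
noncomputable def mulApprox (bs : List ℕ) (c h : ℝ) : ℝ :=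
  4 * (parabolaApprox bs ((c - h + 2) / 4) - parabolaApprox bs ((c + h + 2) / 4))

theorem abs_mulApprox_sub_le {bs : List ℕ} (hbs : ∀ b ∈ bs, 1 ≤ b) {c h : ℝ} (hc : |c| ≤ 1)
    (hh : |h| ≤ 1) : |mulApprox bs c h - c * h| ≤ 1 / (bs.prod : ℝ) ^ 2 := by
  rw [abs_le] at hc hh
  have hquarter : 1 / (4 * (bs.prod : ℝ) ^ 2) = 1 / (bs.prod : ℝ) ^ 2 / 4 := by
    rw [div_div, mul_comm]
  obtain ⟨u0, u1⟩ := sub_sq_sub_parabolaApprox_mem_Icc hbs (x := (c - h + 2) / 4)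
    ⟨by linarith, by linarith⟩
  obtain ⟨v0, v1⟩ := sub_sq_sub_parabolaApprox_mem_Icc hbs (x := (c + h + 2) / 4)
    ⟨by linarith, by linarith⟩
  rw [hquarter] at u1 v1
  rw [mulApprox, abs_le]
  constructor <;> nlinarith

theorem abs_mulApprox_le_one {bs : List ℕ} (hbs : ∀ b ∈ bs, 1 ≤ b) (hprod : 2 ≤ bs.prod) {c h : ℝ}
    (hc : |c| ≤ 1) (hh : |h| ≤ 1 / 2) : |mulApprox bs c h| ≤ 1 := by
  have hε : 1 / (bs.prod : ℝ) ^ 2 ≤ 1 / 2 := by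
    have : (2 : ℝ) ≤ bs.prod := by exact_mod_cast hprod
    apply one_div_le_one_div_of_le <;> nlinarith
  calc |mulApprox bs c h| ≤ |mulApprox bs c h - c * h| + |c * h| := by
        simpa only [sub_add_cancel] using abs_add_le (mulApprox bs c h - c * h) (c * h)
    _ ≤ 1 / 2 + 1 * (1 / 2) := by
        rw [abs_mul]
        gcongr
        exact (abs_mulApprox_sub_le hbs hc (hh.trans (by norm_num))).trans hε
    _ = 1 := by norm_num

theorem abs_list_prod_le_one {R : Type*} [CommRing R] [LinearOrder R] [IsStrictOrderedRing R]
    {l : List R} (hl : ∀ a ∈ l, |a| ≤ 1) : |l.prod| ≤ 1 := by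
  induction l with
  | nil => simp
  | cons a l ih =>
    rw [List.forall_mem_cons] at hl
    rw [List.prod_cons, abs_mul]
    exact mul_le_one₀ hl.1 (abs_nonneg _) (ih hl.2)

theorem abs_foldl_mulApprox_sub_le {bs : List ℕ} (hbs : ∀ b ∈ bs, 1 ≤ b) (hprod : 2 ≤ bs.prod)
    {c : ℝ} (hc : |c| ≤ 1) {l : List ℝ} (hl : ∀ a ∈ l, |a| ≤ 1 / 2) :
    |l.foldl (mulApprox bs) c - c * l.prod| ≤ l.length / (bs.prod : ℝ) ^ 2 := by
  induction l generalizing c with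
  | nil => simp
  | cons a l ih =>
    rw [List.forall_mem_cons] at hl
    have hrest := ih (abs_mulApprox_le_one hbs hprod hc hl.1) hl.2
    have hstep : |mulApprox bs c a - c * a| * |l.prod| ≤ 1 / (bs.prod : ℝ) ^ 2 * 1 := by
      gcongr
      · exact abs_mulApprox_sub_le hbs hc (hl.1.trans (by norm_num))
      · exact abs_list_prod_le_one fun b hb => (hl.2 b hb).trans (by norm_num)
    rw [List.foldl_cons, List.prod_cons, List.length_cons, Nat.cast_succ, add_div]
    calc |l.foldl (mulApprox bs) (mulApprox bs c a) - c * (a * l.prod)|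
        = |(l.foldl (mulApprox bs) (mulApprox bs c a) - mulApprox bs c a * l.prod) +
            (mulApprox bs c a - c * a) * l.prod| := by ring_nf
      _ ≤ _ := (abs_add_le _ _).trans (add_le_add hrest (by rwa [abs_mul, ← mul_one (1 / _)]))

namespace Computes

variable {m : ℕ} {S : Set (Fin m → ℝ)} {w D : ℕ} {κ : Type} [Fintype κ] {C : (Fin m → ℝ) → κ → ℝ}

theorem iterate_stripDigit {τ : Type} [Fintype τ] {n : (Fin m → ℝ) → τ → ℕ}
    {f : (Fin m → ℝ) → τ → ℝ} {δ : ℝ} (hδ : 0 < δ) (hf : ∀ x ∈ S, ∀ i, f x i ∈ Set.Icc 0 (1 - δ))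
    {B R : ℕ} (hR : 1 ≤ R) (hw : Fintype.card κ * 2 + Fintype.card τ * (2 * B) ≤ w) {bs : List ℕ}
    (hbs : ∀ b ∈ bs, 1 ≤ b ∧ b ≤ B)
    (hF : Computes S w D (fun x => Sum.elim (C x)
      (fun i => ((n x i % (bs.prod * R) : ℕ) : ℝ) + f x i))) :
    Computes S w (D + bs.length) (fun x => Sum.elim (C x)
      (fun i => ((n x i % R : ℕ) : ℝ) + f x i)) := by
  induction bs generalizing D with
  | nil => simpa using hF
  | cons b bs ih =>
    rw [List.forall_mem_cons] at hbs
    have hprod : 1 ≤ bs.prod := List.one_le_prod fun c hc => (hbs.2 c hc).1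
    rw [List.length_cons, add_comm bs.length, ← add_assoc]
    refine ih hbs.2 (hF.step_inr (fun _ => 2 * B) (by simpa using hw) fun i => ?_)
    refine ⟨_, (IsShallow.stripDigit hbs.1.1 (bs.prod * R : ℕ) δ (.coord (.inr i))).mono
      (Nat.mul_le_mul_left 2 hbs.1.2), fun x hx => ?_⟩
    rw [Sum.elim_inr, List.prod_cons, mul_assoc, stripDigit_mod_mul hbs.1.1
      (Nat.mul_pos hprod hR) hδ (hf x hx i).1 (hf x hx i).2]

theorem add_parabolaApprox_sub {u v a : (Fin m → ℝ) → ℝ} {B : ℕ} (t : ℝ)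
    (hw : Fintype.card κ * 2 + (4 * B + 2) ≤ w) {bs : List ℕ} (hbs : ∀ b ∈ bs, 1 ≤ b ∧ b ≤ B)
    (hF : Computes S w D (fun x => Sum.elim (C x) ![u x, v x, a x])) :
    Computes S w (D + bs.length) (fun x => Sum.elim (C x) (fun _ : Unit =>
      a x + t * (parabolaApprox bs (u x) - parabolaApprox bs (v x)))) := by
  induction bs generalizing D u v a t with
  | nil => exact hF.affine_inr fun _ => ⟨_, .coord (.inr 2), fun x _ => by simp [parabolaApprox]⟩
  | cons b bs ih =>
    rw [List.forall_mem_cons] at hbs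
    obtain ⟨⟨hb, hbB⟩, hbs⟩ := hbs
    have hstep : Computes S w (D + 1) (fun x => Sum.elim (C x) ![zigzag b (u x), zigzag b (v x),
        a x + t * (parabolaInterp b (u x) - parabolaInterp b (v x))]) := by
      refine hF.step_inr ![B, B, 2 + (B + B)] (by simp [Fin.sum_univ_succ]; lia) fun k => ?_
      fin_cases k
      · exact ⟨_, (IsShallow.zigzag hb (.coord (.inr 0))).mono hbB, fun x _ => rfl⟩
      · exact ⟨_, (IsShallow.zigzag hb (.coord (.inr 1))).mono hbB, fun x _ => rfl⟩
      · exact ⟨_, (IsShallow.coord (.inr 2)).add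
          ((((IsShallow.parabolaInterp hb (.coord (.inr 0))).mono hbB).sub
          ((IsShallow.parabolaInterp hb (.coord (.inr 1))).mono hbB)).const_mul t),
          fun x _ => rfl⟩
    rw [List.length_cons, add_comm bs.length, ← add_assoc]
    refine (ih (t / (b : ℝ) ^ 2) hbs hstep).congr fun x _ => Sum.rec (fun _ => rfl) fun _ => ?_
    simp only [Sum.elim_inr, parabolaApprox]
    ring

theorem mulApprox_coord {c : (Fin m → ℝ) → ℝ} {B : ℕ} (hw : Fintype.card κ * 2 + (4 * B + 2) ≤ w)
    {bs : List ℕ} (hbs : ∀ b ∈ bs, 1 ≤ b ∧ b ≤ B) (i : κ)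
    (hF : Computes S w D (fun x => Sum.elim (C x) (fun _ : Unit => c x))) :
    Computes S w (D + bs.length) (fun x => Sum.elim (C x) (fun _ : Unit =>
      mulApprox bs (c x) (C x i))) := by
  have hpolar : Computes S w D (fun x => Sum.elim (C x)
      ![(c x - C x i + 2) / 4, (c x + C x i + 2) / 4, 0]) := by
    refine hF.affine_inr fun k => ?_
    fin_cases k
    · exact ⟨_, (((IsAffine.coord (.inr ())).sub (.coord (.inl i))).add (.const 2)).div_const 4,
        fun x _ => rfl⟩
    · exact ⟨_, (((IsAffine.coord (.inr ())).add (.coord (.inl i))).add (.const 2)).div_const 4,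
        fun x _ => rfl⟩
    · exact ⟨_, .const 0, fun x _ => rfl⟩
  simpa only [zero_add, mulApprox] using add_parabolaApprox_sub 4 hw hbs hpolar

theorem foldl_mulApprox {c : (Fin m → ℝ) → ℝ} {B : ℕ} (hw : Fintype.card κ * 2 + (4 * B + 2) ≤ w)
    {bs : List ℕ} (hbs : ∀ b ∈ bs, 1 ≤ b ∧ b ≤ B) (l : List κ)
    (hF : Computes S w D (fun x => Sum.elim (C x) (fun _ : Unit => c x))) :
    Computes S w (D + l.length * bs.length) (fun x => Sum.elim (C x) (fun _ : Unit =>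
      (l.map (C x)).foldl (mulApprox bs) (c x))) := by
  induction l generalizing c D with
  | nil => simpa using hF
  | cons i l ih =>
    rw [List.length_cons, add_mul, one_mul, add_comm (_ * _), ← add_assoc]
    exact ih (hF.mulApprox_coord hw hbs i)

end Computes

/-! ### Table look-up -/

/-- Indicator that the digit of weight `R` of the natural number `z` is `i`. -/
noncomputable def digitIndicator (R : ℝ) (i : ℕ) (z : ℝ) : ℝ :=
  ramp 1 (z - i * R) - ramp 1 (z - (i + 1) * R)

theorem digitIndicator_mul_add {R n : ℕ} (hn : n < R) (i k : ℕ) :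
    digitIndicator R i (R * k + n) = if k = i then 1 else 0 := by
  have hdiv : (R * k + n) / R = k := by
    rw [Nat.mul_add_div (by lia), Nat.div_eq_of_lt hn, add_zero]
  have hramp (t : ℕ) : ramp 1 ((R * k + n : ℝ) - t * R) = if t ≤ k then 1 else 0 := by
    have := ramp_natCast_add_sub one_pos le_rfl (sub_self 1).ge (R * k + n) (t * R)
    simpa only [← Nat.le_div_iff_mul_le (n.zero_le.trans_lt hn), hdiv, Nat.cast_add, Nat.cast_mul,
      add_zero] using this
  have hsucc := hramp (i + 1)
  push_cast at hsucc
  rw [digitIndicator, hramp, hsucc]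
  split_ifs <;> first | lia | norm_num

theorem IsShallow.digitIndicator {V : Type*} [AddCommGroup V] [Module ℝ V] {f : V → ℝ} (R : ℝ)
    (i : ℕ) (hf : IsAffine f) : IsShallow 4 (fun v => digitIndicator R i (f v)) :=
  (IsShallow.ramp 1 (hf.sub (.const _))).sub (IsShallow.ramp 1 (hf.sub (.const _)))

/-- The value `a` once the loop counter `t` has passed the position `τ`, and `0` before: the content
of an accumulator to which a loop adds `a` at step `τ`. -/
def revealed (τ t : ℕ) (a : ℝ) : ℝ := if τ < t then a else 0

theorem revealed_zero (τ : ℕ) (a : ℝ) : revealed τ 0 a = 0 := if_neg τ.not_lt_zero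

theorem revealed_of_lt {τ t : ℕ} (h : τ < t) (a : ℝ) : revealed τ t a = a := if_pos h

theorem revealed_succ (τ t : ℕ) (a : ℝ) :
    revealed τ (t + 1) a = revealed τ t a + if τ = t then a else 0 := by
  unfold revealed
  split_ifs <;> first | lia | simp

theorem sum_relu_eq_ite {ι : Type*} [Fintype ι] [DecidableEq ι] {c : ι → ℝ} {b : ℝ}
    (hc : ∀ i, c i ∈ Set.Icc 0 b) (p : ι) (P : Prop) [Decidable P] :
    ∑ i, max 0 (c i + b * (Pi.single p 1 : ι → ℝ) i + b * (if P then 1 else 0) - 2 * b) =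
      if P then c p else 0 := by
  rw [Finset.sum_eq_single p]
  · obtain ⟨h0, h1⟩ := hc p
    rw [Pi.single_eq_same]
    split_ifs
    · rw [max_eq_right (by linarith)]; ring
    · rw [max_eq_left (by linarith)]
  · intro i _ hi
    obtain ⟨h0, h1⟩ := hc i
    rw [Pi.single_eq_of_ne hi, max_eq_left]
    split_ifs <;> linarith
  · simp

theorem relu_sub_abs_eq_ite {z : ℝ} (hz : z ∈ Set.Icc (0 : ℝ) 1) (l u : ℕ) :
    max 0 (z - |(l : ℝ) - u|) = if l = u then z else 0 := by
  split_ifs with h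
  · rw [h, sub_self, abs_zero, sub_zero, max_eq_right hz.1]
  · have : (1 : ℤ) ≤ |(l : ℤ) - u| := Int.one_le_abs (by lia)
    have : (1 : ℝ) ≤ |(l : ℝ) - u| := by exact_mod_cast this
    exact max_eq_left (by linarith [hz.2])

/-- The number `0.y₍ₙ₋₁₎…y₁y₀` in base `A`, where `yᵢ` are the base-`A` digits of `y`. -/
noncomputable def digitTail (A y n : ℕ) : ℝ := ((y % A ^ n : ℕ) : ℝ) / (A : ℝ) ^ n

theorem digitTail_mem_Icc {A : ℕ} (hA : 1 ≤ A) (y n : ℕ) : digitTail A y n ∈ Set.Icc (0 : ℝ) 1 := by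
  refine ⟨by rw [digitTail]; positivity, div_le_one_of_le₀ ?_ (by positivity)⟩
  exact_mod_cast (Nat.mod_lt y (Nat.pow_pos hA)).le

theorem digitTail_ofDigits_mem_Icc {A : ℕ} (hA : 1 ≤ A) {L : List ℕ} (hL : ∀ a ∈ L, a < A) {j : ℕ}
    (hj : j < L.length) :
    digitTail A (Nat.ofDigits A L) (j + 1) ∈ Set.Icc ((L[j] : ℝ) / A) ((L[j] + 1) / A) := by
  have : (0 : ℝ) < A := by exact_mod_cast hA
  have hsplit : Nat.ofDigits A L % A ^ (j + 1) = Nat.ofDigits A L % A ^ j + A ^ j * L[j] := by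
    rw [Nat.ofDigits_mod_pow_eq_ofDigits_take _ hA _ hL,
      Nat.ofDigits_mod_pow_eq_ofDigits_take _ hA _ hL, List.take_succ_eq_append_getElem hj,
      Nat.ofDigits_append, List.length_take_of_le hj.le, Nat.ofDigits_singleton]
  have heq : digitTail A (Nat.ofDigits A L) (j + 1) =
      (L[j] + digitTail A (Nat.ofDigits A L) j) / A := by
    simp only [digitTail, hsplit, Nat.cast_add, Nat.cast_mul, Nat.cast_pow]
    field
  obtain ⟨h0, h1⟩ := digitTail_mem_Icc hA (Nat.ofDigits A L) j
  rw [heq]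
  exact ⟨by gcongr; linarith, by gcongr⟩

/-- The entries of a row are packed in reverse order, so that removing leading digits brings them to
the front one after the other. -/
theorem exists_packed_rows {A : ℕ} (hA : 1 ≤ A) {ξ : ℕ → ℝ} (hξ : ∀ n, ξ n ∈ Set.Icc (0 : ℝ) 1)
    (M : ℕ) : ∃ y : ℕ → ℕ, (∀ n, y n < A ^ M) ∧
      ∀ n l, l < M → |digitTail A (y n) (M - l) - ξ (M * n + l)| ≤ 1 / A := by
  have hA0 : (0 : ℝ) < A := by exact_mod_cast hA
  choose v hv hvξ hξv using fun n => exists_natCast_le_le_add_one hA (y := ξ n * A)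
    (mul_nonneg (hξ n).1 hA0.le) (mul_le_of_le_one_left hA0.le (hξ n).2)
  set L : ℕ → List ℕ := fun n => List.ofFn fun i : Fin M => v (M * n + i.rev) with hLdef
  have hL (n : ℕ) : ∀ a ∈ L n, a < A := by
    simp only [hLdef, List.mem_ofFn]
    rintro _ ⟨i, rfl⟩
    exact (hv _).trans_lt (Nat.sub_one_lt (by lia))
  refine ⟨fun n => Nat.ofDigits A (L n), fun n => ?_, fun n l hl => ?_⟩
  · have hmod := Nat.ofDigits_mod_pow_eq_ofDigits_take M hA _ (hL n)
    rw [List.take_of_length_le (by simp [hLdef])] at hmod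
    exact hmod.symm.trans_lt (Nat.mod_lt _ (Nat.pow_pos hA))
  · have hget : (L n)[M - 1 - l]'(by simp only [hLdef, List.length_ofFn]; lia) = v (M * n + l) := by
      simp only [hLdef, List.getElem_ofFn, Fin.val_rev]
      congr 2
      lia
    have htail := digitTail_ofDigits_mem_Icc hA (hL n) (j := M - 1 - l)
      (by simp only [hLdef, List.length_ofFn]; lia)
    rw [hget, show M - 1 - l + 1 = M - l by lia] at htail
    have hlow : (v (M * n + l) : ℝ) / A ≤ ξ (M * n + l) := (div_le_iff₀ hA0).mpr (hvξ _)
    have hupp : ξ (M * n + l) ≤ (v (M * n + l) + 1) / A := (le_div_iff₀ hA0).mpr (hξv _)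
    rw [add_div] at htail hupp
    exact abs_sub_le_iff.mpr ⟨by linarith [htail.2], by linarith [htail.1]⟩

theorem exists_eq_mixed_radix {N M n : ℕ} (hn : n < (N * M) ^ 2) :
    ∃ (p q : Fin N) (t l : Fin M), n = N * (M * M) * p + (M * M * q + (M * t + l)) := by
  obtain ⟨⟨p, n₁⟩, h₁⟩ := finProdFinEquiv.surjective
    (⟨n, hn.trans_eq (by ring)⟩ : Fin (N * (N * (M * M))))
  obtain ⟨⟨q, n₂⟩, rfl⟩ := finProdFinEquiv.surjective n₁
  obtain ⟨⟨t, l⟩, rfl⟩ := finProdFinEquiv.surjective n₂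
  refine ⟨p, q, t, l, ?_⟩
  have := congrArg Fin.val h₁
  simp only [finProdFinEquiv_apply_val] at this
  lia

namespace Computes

variable {m : ℕ} {S : Set (Fin m → ℝ)} {w D : ℕ} {κ : Type} [Fintype κ] {C : (Fin m → ℝ) → κ → ℝ}

theorem split_leading_digit {N R : ℕ} {i : (Fin m → ℝ) → Fin N} {n : (Fin m → ℝ) → ℕ}
    (hn : ∀ x ∈ S, n x < R) (hw : Fintype.card κ * 2 + 6 * N ≤ w)
    (hF : Computes S w D (fun x => Sum.elim (C x) (fun _ : Unit => ((R * i x + n x : ℕ) : ℝ)))) :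
    Computes S w (D + 1) (fun x => Sum.elim (Sum.elim (C x) (Pi.single (i x) 1))
      (fun _ : Unit => (n x : ℝ))) := by
  refine hF.step (Sum.elim (Sum.elim (fun _ => 2) (fun _ : Fin N => 4)) (fun _ => 2 * N))
    (by simp; lia) ?_
  rintro ((k | k) | k)
  · exact ⟨_, .coord (.inl k), fun x _ => rfl⟩
  · refine ⟨_, .digitIndicator R k (.coord (.inr ())), fun x hx => ?_⟩
    simp [digitIndicator_mul_add (hn x hx), Pi.single_apply, Fin.ext_iff, eq_comm]
  · by_cases hN : N = 0
    · exact ⟨_, .const 0, fun x _ => (Fin.cast hN (i x)).elim0⟩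
    refine ⟨_, .stripDigit (b := N) (by lia) R 1 (.coord (.inr ())), fun x hx => ?_⟩
    have hR : 0 < R := (n x).zero_le.trans_lt (hn x hx)
    have hstrip := stripDigit_mod_mul (n := R * i x + n x) (b := N) (by lia) hR one_pos
      le_rfl (sub_self (1 : ℝ)).ge
    rw [Nat.mod_eq_of_lt (Nat.mul_add_lt_mul_of_lt_of_lt (i x).isLt (hn x hx)),
      Nat.mul_add_mod, Nat.mod_eq_of_lt (hn x hx), add_zero, add_zero] at hstrip
    exact hstrip.symm

section Fetch

variable {N M : ℕ} {p q : (Fin m → ℝ) → Fin N} {τ l : (Fin m → ℝ) → ℕ} {Y : Fin N → Fin N → ℕ → ℝ}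

theorem fetch_step {t : ℕ} (hl : ∀ x ∈ S, l x < M) (hY : ∀ i k, 0 ≤ Y i k t)
    (hw : Fintype.card κ * 2 + (5 * N + 12) ≤ w)
    (hF : Computes S w D (fun x => Sum.elim
      (Sum.elim (Sum.elim (C x) (Pi.single (p x) 1)) (Pi.single (q x) 1))
      ![((M * τ x + l x : ℕ) : ℝ), if τ x = t then 1 else 0,
        revealed (τ x) t (Y (p x) (q x) (τ x)), revealed (τ x) t (M * τ x)])) :
    Computes S w (D + 1) (fun x => Sum.elim
      (Sum.elim (Sum.elim (C x) (Pi.single (p x) 1)) (Pi.single (q x) 1))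
      ![((M * τ x + l x : ℕ) : ℝ), if τ x = t + 1 then 1 else 0,
        revealed (τ x) (t + 1) (Y (p x) (q x) (τ x)), revealed (τ x) (t + 1) (M * τ x)]) := by
  obtain ⟨b, hb⟩ := Finite.exists_le fun ik : Fin N × Fin N => Y ik.1 ik.2 t
  refine hF.step_inr ![2, 4, 2 + N, 2] (by simp [Fin.sum_univ_succ]; lia) fun k => ?_
  fin_cases k
  · exact ⟨_, .coord (.inr 0), fun x _ => rfl⟩
  · refine ⟨_, .digitIndicator M (t + 1) (.coord (.inr 0)), fun x hx => ?_⟩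
    simp [digitIndicator_mul_add (hl x hx)]
  · have hrow : IsShallow N fun v : ((κ ⊕ Fin N) ⊕ Fin N) ⊕ Fin 4 → ℝ =>
        ∑ i, max 0 (∑ k, Y i k t * v (.inl (.inr k)) + b * v (.inl (.inl (.inr i))) +
          b * v (.inr 1) - 2 * b) := by
      have hneuron (i : Fin N) := (((IsAffine.sum Finset.univ fun k => (IsAffine.coord
        (ι := ((κ ⊕ Fin N) ⊕ Fin N) ⊕ Fin 4) (.inl (.inr k))).const_mul (Y i k t)).add
        ((IsAffine.coord (.inl (.inl (.inr i)))).const_mul b)).add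
        ((IsAffine.coord (.inr 1)).const_mul b)).sub (.const (2 * b))
      simpa using IsShallow.sum Finset.univ fun i => .relu (hneuron i)
    refine ⟨_, (IsShallow.coord (.inr 2)).add hrow, fun x _ => ?_⟩
    have hsum := sum_relu_eq_ite (c := fun i => Y i (q x) t) (fun i => ⟨hY i _, hb (i, q x)⟩)
      (p x) (τ x = t)
    simp only [Sum.elim_inl, Sum.elim_inr, Pi.single_apply, mul_ite, mul_one, mul_zero,
      Finset.sum_ite_eq', Finset.mem_univ, if_true] at hsum ⊢
    simp +contextual [revealed_succ, hsum]
  · refine ⟨_, .of_affine ((IsAffine.coord (.inr 3)).add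
      ((IsAffine.coord (.inr 1)).const_mul (M * t))), fun x _ => ?_⟩
    simp +contextual [revealed_succ]

theorem fetch (hτ : ∀ x ∈ S, τ x < M) (hl : ∀ x ∈ S, l x < M) (hY : ∀ i k t, 0 ≤ Y i k t)
    (hw : Fintype.card κ * 2 + (5 * N + 12) ≤ w)
    (hF : Computes S w D (fun x => Sum.elim
      (Sum.elim (Sum.elim (C x) (Pi.single (p x) 1)) (Pi.single (q x) 1))
      (fun _ : Unit => ((M * τ x + l x : ℕ) : ℝ)))) :
    Computes S w (D + (M + 1)) (fun x => Sum.elim (C x)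
      ![(l x : ℝ), Y (p x) (q x) (τ x)]) := by
  have hloop (t : ℕ) : Computes S w (D + 1 + t) (fun x => Sum.elim
      (Sum.elim (Sum.elim (C x) (Pi.single (p x) 1)) (Pi.single (q x) 1))
      ![((M * τ x + l x : ℕ) : ℝ), if τ x = t then 1 else 0,
        revealed (τ x) t (Y (p x) (q x) (τ x)), revealed (τ x) t (M * τ x)]) := by
    induction t with
    | zero =>
      refine hF.step_inr ![2, 4, 0, 0] (by simp [Fin.sum_univ_succ]; lia) fun k => ?_
      fin_cases k
      · exact ⟨_, .coord (.inr ()), fun x _ => rfl⟩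
      · refine ⟨_, .digitIndicator M 0 (.coord (.inr ())), fun x hx => ?_⟩
        simp [digitIndicator_mul_add (hl x hx)]
      · exact ⟨_, .const 0, fun x _ => revealed_zero (τ x) (Y (p x) (q x) (τ x))⟩
      · exact ⟨_, .const 0, fun x _ => revealed_zero (τ x) (M * τ x)⟩
    | succ t ih => exact ih.fetch_step hl (fun i k => hY i k t) hw
  have hlast := hloop M
  rw [add_assoc, add_comm 1] at hlast
  refine hlast.affine (Sum.rec (fun k => ⟨_, .coord (.inl (.inl (.inl k))), fun x _ => rfl⟩)
    fun k => ?_)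
  fin_cases k
  · refine ⟨_, (IsAffine.coord (.inr 0)).sub (.coord (.inr 3)), fun x hx => ?_⟩
    simp [revealed_of_lt (hτ x hx)]
  · exact ⟨_, .coord (.inr 2), fun x hx => (revealed_of_lt (hτ x hx) _).symm⟩

end Fetch

section SelectTail

variable {l y : (Fin m → ℝ) → ℕ} {M B : ℕ} {bs : List ℕ}

theorem selectTail_accumulate {A u : ℕ} (hA : 1 ≤ A) (hw : Fintype.card κ * 2 + 9 ≤ w)
    (hF : Computes S w D (fun x => Sum.elim
      (Sum.elim (C x) ![(l x : ℝ), revealed (l x) u (digitTail A (y x) (M - l x))])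
      (fun _ : Unit => ((y x % A ^ (M - u) : ℕ) : ℝ)))) :
    Computes S w (D + 2) (fun x => Sum.elim
      (Sum.elim (C x) ![(l x : ℝ), revealed (l x) (u + 1) (digitTail A (y x) (M - l x))])
      (fun _ : Unit => ((y x % A ^ (M - u) : ℕ) : ℝ))) := by
  have hdist : Computes S w (D + 1) (fun x => Sum.elim
      (Sum.elim (C x) ![(l x : ℝ), revealed (l x) u (digitTail A (y x) (M - l x))])
      ![((y x % A ^ (M - u) : ℕ) : ℝ), |(l x : ℝ) - u|]) := by
    refine hF.step_inr ![2, 2] (by simp; lia) fun k => ?_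
    fin_cases k
    · exact ⟨_, .coord (.inr ()), fun x _ => rfl⟩
    · have hsub := (IsAffine.coord (ι := (κ ⊕ Fin 2) ⊕ Unit) (.inl (.inr 0))).sub (.const u)
      refine ⟨_, (IsShallow.relu hsub).add (.relu hsub.neg), fun x _ => ?_⟩
      simp only [max_comm (0 : ℝ), max_zero_add_max_neg_zero_eq_abs_self]
      rfl
  refine hdist.step (Sum.elim (Sum.elim (fun _ => 2) ![2, 3]) (fun _ => 2))
    (by simp; lia) ?_
  rintro ((k | k) | k)
  · exact ⟨_, .coord (.inl (.inl k)), fun x _ => rfl⟩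
  · fin_cases k
    · exact ⟨_, .coord (.inl (.inr 0)), fun x _ => rfl⟩
    · refine ⟨_, (IsShallow.coord (.inl (.inr 1))).add (.relu
        (((IsAffine.coord (.inr 0)).div_const ((A : ℝ) ^ (M - u))).sub (.coord (.inr 1)))),
        fun x _ => ?_⟩
      have hgate := relu_sub_abs_eq_ite (digitTail_mem_Icc hA (y x) (M - u)) (l x) u
      rw [digitTail] at hgate
      simp +contextual [revealed_succ, hgate, digitTail]
  · exact ⟨_, .coord (.inr 0), fun x _ => rfl⟩

theorem selectTail (hbs : ∀ b ∈ bs, 1 ≤ b ∧ b ≤ B) (hl : ∀ x ∈ S, l x < M)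
    (hy : ∀ x ∈ S, y x < bs.prod ^ M) (hw : Fintype.card κ * 2 + (2 * B + 9) ≤ w)
    (hF : Computes S w D (fun x => Sum.elim (C x) ![(l x : ℝ), (y x : ℝ)])) :
    Computes S w (D + M * (2 + bs.length)) (fun x => Sum.elim (C x) (fun _ : Unit =>
      digitTail bs.prod (y x) (M - l x))) := by
  have hA : 1 ≤ bs.prod := List.one_le_prod fun c hc => (hbs c hc).1
  have hloop : ∀ u ≤ M, Computes S w (D + u * (2 + bs.length)) (fun x => Sum.elim
      (Sum.elim (C x) ![(l x : ℝ), revealed (l x) u (digitTail bs.prod (y x) (M - l x))])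
      (fun _ : Unit => ((y x % bs.prod ^ (M - u) : ℕ) : ℝ))) := by
    intro u hu
    induction u with
    | zero =>
      rw [zero_mul, add_zero]
      refine hF.affine ?_
      rintro ((k | k) | k)
      · exact ⟨_, .coord (.inl k), fun x _ => rfl⟩
      · fin_cases k
        · exact ⟨_, .coord (.inr 0), fun x _ => rfl⟩
        · exact ⟨_, .const 0, fun x _ => revealed_zero (l x) (digitTail bs.prod (y x) (M - l x))⟩
      · exact ⟨_, .coord (.inr 1), fun x hx => by simp [Nat.mod_eq_of_lt (hy x hx)]⟩
    | succ u ih =>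
      have hacc := (ih (by lia)).selectTail_accumulate hA (by lia)
      rw [show M - u = M - (u + 1) + 1 by lia, pow_succ'] at hacc
      rw [add_one_mul, ← add_assoc, ← add_assoc]
      simpa only [add_zero] using iterate_stripDigit (n := fun x _ => y x) (f := fun _ _ => 0)
        (C := fun x => Sum.elim (C x)
          ![(l x : ℝ), revealed (l x) (u + 1) (digitTail bs.prod (y x) (M - l x))])
        one_pos (fun _ _ _ => ⟨le_rfl, (sub_self (1 : ℝ)).ge⟩) (Nat.one_le_pow _ _ hA)
        (by simp; lia) hbs (by simpa only [add_zero] using hacc)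
  refine (hloop M le_rfl).affine ?_
  rintro (k | k)
  · exact ⟨_, .coord (.inl (.inl k)), fun x _ => rfl⟩
  · exact ⟨_, .coord (.inl (.inr 1)), fun x hx => (revealed_of_lt (hl x hx) _).symm⟩

end SelectTail

theorem exists_lookup {N M B : ℕ} [NeZero N] [NeZero M] {bs : List ℕ}
    (hbs : ∀ b ∈ bs, 1 ≤ b ∧ b ≤ B) {ξ : ℕ → ℝ} (hξ : ∀ n, ξ n ∈ Set.Icc (0 : ℝ) 1)
    {θ : (Fin m → ℝ) → ℕ} (hθ : ∀ x ∈ S, θ x < (N * M) ^ 2)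
    (hw : Fintype.card κ * 2 + (8 * N + 2 * B + 12) ≤ w)
    (hF : Computes S w D (fun x => Sum.elim (C x) (fun _ : Unit => (θ x : ℝ)))) :
    ∃ out : (Fin m → ℝ) → ℝ,
      Computes S w (D + (M * (2 + bs.length) + M + 3))
        (fun x => Sum.elim (C x) (fun _ : Unit => out x)) ∧
      ∀ x ∈ S, out x ∈ Set.Icc (0 : ℝ) 1 ∧ |out x - ξ (θ x)| ≤ 1 / bs.prod := by
  have hA : 1 ≤ bs.prod := List.one_le_prod fun c hc => (hbs c hc).1
  obtain ⟨y, hyA, hyξ⟩ := exists_packed_rows hA hξ M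
  choose! p q t l hθeq using fun x hx => exists_eq_mixed_radix (hθ x hx)
  have hsplit : Computes S w (D + 1 + 1) (fun x => Sum.elim
      (Sum.elim (Sum.elim (C x) (Pi.single (p x) 1)) (Pi.single (q x) 1))
      (fun _ : Unit => ((M * t x + l x : ℕ) : ℝ))) := by
    have hlow (x) : M * t x + l x < M * M :=
      Nat.mul_add_lt_mul_of_lt_of_lt (t x).isLt (l x).isLt
    have hmid (x) : M * M * q x + (M * t x + l x) < N * (M * M) :=
      Nat.mul_add_lt_mul_of_lt_of_lt (q x).isLt (hlow x)
    exact split_leading_digit (fun x _ => hlow x) (by simp; lia)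
      (split_leading_digit (fun x _ => hmid x) (by lia)
        (hF.congr fun x hx => Sum.rec (fun _ => rfl) fun _ => by simp [← hθeq x hx]))
  have hrow := fetch (Y := fun p q t => y ((p * N + q) * M + t)) (fun x _ => (t x).isLt)
    (fun x _ => (l x).isLt) (fun _ _ _ => Nat.cast_nonneg _) (by lia) hsplit
  have htail := hrow.selectTail (y := fun x => y ((p x * N + q x) * M + t x)) hbs
    (fun x _ => (l x).isLt) (fun x _ => hyA _) (by lia)
  refine ⟨_, by convert htail using 1; ring, fun x hx => ⟨digitTail_mem_Icc hA _ _, ?_⟩⟩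
  convert hyξ _ _ (l x).isLt using 4
  rw [hθeq x hx]
  ring

end Computes

/-! ### Locating the grid cell -/

/-- `[0,1]` without the intervals of length `δ` to the left of the grid points `k / K`. -/
def safeInterval (K : ℕ) (δ : ℝ) : Set ℝ :=
  {x ∈ Set.Icc 0 1 | ∀ k : ℕ, 1 ≤ k → k < K → x ∉ Set.Ioo ((k : ℝ) / K - δ) (k / K)}

/-- The number of cells of length `2 / K` that are needed to cover `[0,1]`. -/
def cellCount (K : ℕ) : ℕ := (K + 1) / 2

theorem cellCount_pos {K : ℕ} (hK : 1 ≤ K) : 0 < cellCount K := by grind [cellCount]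

/-- The midpoint of the cell `[2q / K, (2q + 2) / K]`. -/
noncomputable def cellCenter (K q : ℕ) : ℝ := (2 * q + 1) / K

theorem cellCenter_mem_Icc {K q : ℕ} (hq : q < cellCount K) : cellCenter K q ∈ Set.Icc 0 1 := by
  have h : 2 * q + 1 ≤ K := by grind [cellCount]
  exact ⟨by rw [cellCenter]; positivity, div_le_one_of_le₀ (by exact_mod_cast h) K.cast_nonneg⟩

/-- The position of the coordinate `x`, in units of the cell length `2 / K`, moved slightly away
from the right end of the last cell. -/
noncomputable def cellPosition (K : ℕ) (δ x : ℝ) : ℝ := min (x * K / 2) (cellCount K - δ * K / 2)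

theorem IsShallow.cellPosition {V : Type*} [AddCommGroup V] [Module ℝ V] {f : V → ℝ} (K : ℕ)
    (δ : ℝ) (hf : IsAffine f) : IsShallow 1 (fun v => cellPosition K δ (f v)) := by
  have h := (IsShallow.const (n := 0) (cellCount K - δ * K / 2)).sub (.relu
    ((IsAffine.const (cellCount K - δ * K / 2)).sub ((hf.mul_const K).div_const 2)))
  rw [zero_add] at h
  convert h using 2 with v
  grind [_root_.cellPosition]

/-- The index of the cell of length `2 / K` that contains the coordinate `x`. -/
noncomputable def cellIndex (K : ℕ) (δ x : ℝ) : ℕ := ⌊cellPosition K δ x⌋₊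

section CellIndex

variable {K : ℕ} {δ x : ℝ}

theorem cellPosition_nonneg (hK : 1 ≤ K) (hδK : δ * K < 2) (hx : 0 ≤ x) :
    0 ≤ cellPosition K δ x := by
  have : (1 : ℝ) ≤ cellCount K := Nat.one_le_cast.mpr (cellCount_pos hK)
  exact le_min (by positivity) (by linarith)

theorem cellPosition_of_lt (h : cellPosition K δ x < cellCount K - δ * K / 2) :
    cellPosition K δ x = x * K / 2 :=
  min_eq_left ((min_lt_iff.mp h).resolve_right (lt_irrefl _)).le

theorem cellIndex_lt_cellCount (hK : 1 ≤ K) (hδ : 0 < δ) : cellIndex K δ x < cellCount K := by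
  refine (Nat.floor_lt' (cellCount_pos hK).ne').mpr ((min_le_right _ _).trans_lt ?_)
  have : 0 < δ * K := by positivity
  linarith

theorem cellPosition_sub_cellIndex_mem_Icc (hK : 1 ≤ K) (hδ : 0 < δ) (hδK : δ * K < 2)
    (hx : x ∈ safeInterval K δ) :
    cellPosition K δ x - cellIndex K δ x ∈ Set.Icc 0 (1 - δ * K / 2) := by
  have hz := cellPosition_nonneg hK hδK hx.1.1
  refine ⟨sub_nonneg.mpr (Nat.floor_le hz), ?_⟩
  set q := cellIndex K δ x
  rcases (Nat.succ_le_of_lt (cellIndex_lt_cellCount (x := x) hK hδ)).eq_or_lt with hlast | hinner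
  · have : (q : ℝ) + 1 = cellCount K := by exact_mod_cast hlast
    have : cellPosition K δ x ≤ cellCount K - δ * K / 2 := min_le_right _ _
    linarith
  · have hlt : cellPosition K δ x < q + 1 := Nat.lt_floor_add_one _
    have : (q : ℝ) + 1 + 1 ≤ cellCount K := by exact_mod_cast hinner
    have hpos : cellPosition K δ x = x * K / 2 := cellPosition_of_lt (by linarith)
    rw [hpos] at hlt ⊢
    have hgrid := hx.2 (2 * (q + 1)) (by lia) (by grind [cellCount])
    have hK0 : (0 : ℝ) < K := by exact_mod_cast hK
    have hright : x < (2 * (q + 1) : ℕ) / K := by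
      rw [lt_div_iff₀ hK0]
      push_cast
      linarith
    have hleft := not_lt.mp fun h => hgrid ⟨h, hright⟩
    rw [le_sub_iff_add_le, le_div_iff₀ hK0] at hleft
    push_cast at hleft
    linarith

theorem abs_sub_cellCenter_le (hK : 1 ≤ K) (hδK : δ * K < 2) (hx : x ∈ Set.Icc 0 1) :
    |x - cellCenter K (cellIndex K δ x)| ≤ 1 / K := by
  have hK0 : (0 : ℝ) < K := by exact_mod_cast hK
  set q := cellIndex K δ x
  have hle : (q : ℝ) ≤ cellPosition K δ x := Nat.floor_le (cellPosition_nonneg hK hδK hx.1)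
  have hlt : cellPosition K δ x < q + 1 := Nat.lt_floor_add_one _
  have hlo : 2 * (q : ℝ) ≤ x * K := by
    linarith [hle.trans (min_le_left (x * K / 2) _)]
  have hhi : x * K ≤ 2 * q + 2 := by
    by_cases h : cellPosition K δ x < cellCount K - δ * K / 2
    · rw [cellPosition_of_lt h] at hlt
      linarith
    · have hcount : (cellCount K : ℝ) < q + 1 + 1 := by linarith
      have hKq : K ≤ 2 * q + 2 := by
        have : cellCount K < q + 1 + 1 := by exact_mod_cast hcount
        grind [cellCount]
      calc x * K ≤ K := mul_le_of_le_one_left hK0.le hx.2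
        _ ≤ 2 * q + 2 := by exact_mod_cast hKq
  have heq : x - cellCenter K q = (x * K - (2 * q + 1)) / K := by rw [cellCenter]; field
  rw [heq, abs_div, abs_of_pos hK0]
  gcongr
  exact abs_le.mpr ⟨by linarith, by linarith⟩

end CellIndex

/-- The cell containing `x`, as a number whose base-`cellCount K` digits are the indices of the
coordinates. -/
noncomputable def cellCode {d : ℕ} (K : ℕ) (δ : ℝ) (x : Fin d → ℝ) : ℕ :=
  ∑ i, cellIndex K δ (x i) * cellCount K ^ (i : ℕ)

/-- The center of the cell with code `n`, a point of the unit cube even if `n` is no such code. -/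
noncomputable def centerOfCode {d : ℕ} (K n : ℕ) : Fin d → ℝ :=
  fun i => cellCenter K (n / cellCount K ^ (i : ℕ) % cellCount K)

theorem centerOfCode_mem_Icc {d K : ℕ} (hK : 1 ≤ K) (n : ℕ) :
    (centerOfCode K n : Fin d → ℝ) ∈ Set.Icc 0 1 := by
  have h (i : Fin d) : centerOfCode K n i ∈ Set.Icc 0 1 :=
    cellCenter_mem_Icc (Nat.mod_lt _ (cellCount_pos hK))
  exact ⟨fun i => (h i).1, fun i => (h i).2⟩

theorem cellCode_lt {d K : ℕ} {δ : ℝ} (hK : 1 ≤ K) (hδ : 0 < δ) (x : Fin d → ℝ) :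
    cellCode K δ x < cellCount K ^ d :=
  (finFunctionFinEquiv fun i => ⟨_, cellIndex_lt_cellCount (x := x i) hK hδ⟩).isLt.trans_eq' (by
    simp [cellCode])

theorem centerOfCode_cellCode {d K : ℕ} {δ : ℝ} (hK : 1 ≤ K) (hδ : 0 < δ) (x : Fin d → ℝ) :
    centerOfCode K (cellCode K δ x) = fun i => cellCenter K (cellIndex K δ (x i)) := by
  funext i
  have hdecode := congrArg Fin.val (congrFun (finFunctionFinEquiv.symm_apply_apply
    fun i => (⟨_, cellIndex_lt_cellCount (x := x i) hK hδ⟩ : Fin (cellCount K))) i)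
  rw [finFunctionFinEquiv_symm_apply_val, finFunctionFinEquiv_apply] at hdecode
  exact congrArg _ hdecode

theorem Computes.sub_center_cellCode {d K B : ℕ} {δ : ℝ} {S : Set (Fin d → ℝ)} {w : ℕ}
    (hK : 1 ≤ K) (hδ : 0 < δ) (hδK : δ * K < 2) (hS : ∀ x ∈ S, ∀ i, x i ∈ safeInterval K δ)
    {bs : List ℕ} (hbs : ∀ b ∈ bs, 1 ≤ b ∧ b ≤ B) (hprod : cellCount K ≤ bs.prod)
    (hw : d * (2 * B + 4) ≤ w) :
    Computes S w (1 + bs.length) (fun x => Sum.elim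
      (fun i => x i - centerOfCode K (cellCode K δ x) i)
      (fun _ : Unit => (cellCode K δ x : ℝ))) := by
  have hstate : Computes S w 1 (fun x => Sum.elim
      (Sum.elim (fun i => x i) (fun i => cellPosition K δ (x i)))
      (fun i => ((cellIndex K δ (x i) % (bs.prod * 1) : ℕ) : ℝ) +
        (cellPosition K δ (x i) - cellIndex K δ (x i)))) := by
    refine Computes.input.step (Sum.elim (Sum.elim (fun _ => 2) (fun _ => 1)) (fun _ => 1))
      (by simp; lia) ?_
    rintro ((i | i) | i)
    · exact ⟨_, .coord i, fun x _ => rfl⟩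
    · exact ⟨_, .cellPosition K δ (.coord i), fun x _ => rfl⟩
    · refine ⟨_, .cellPosition K δ (.coord i), fun x _ => ?_⟩
      rw [Sum.elim_inr, mul_one, Nat.mod_eq_of_lt ((cellIndex_lt_cellCount hK hδ).trans_le hprod),
        add_sub_cancel]
  have hfrac := iterate_stripDigit (δ := δ * K / 2) (by positivity)
    (fun x hx i => cellPosition_sub_cellIndex_mem_Icc hK hδ hδK (hS x hx i)) le_rfl
    (by simp; lia) hbs hstate
  have hindex : Computes S w (1 + bs.length) (fun x => Sum.elim (fun i => x i)
      (fun i => (cellIndex K δ (x i) : ℝ))) := by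
    refine hfrac.affine (Sum.rec (fun i => ⟨_, .coord (.inl (.inl i)), fun x _ => rfl⟩) fun i =>
      ⟨_, (IsAffine.coord (.inl (.inr i))).sub (.coord (.inr i)), fun x _ => ?_⟩)
    simp [Nat.mod_one]
  refine hindex.affine ?_
  rintro (i | _)
  · refine ⟨_, (IsAffine.coord (.inl i)).sub
      ((((IsAffine.coord (.inr i)).const_mul 2).add (.const 1)).div_const K), fun x _ => ?_⟩
    simp [centerOfCode_cellCode hK hδ, cellCenter]
  · refine ⟨_, IsAffine.sum Finset.univ fun i : Fin d =>
      (IsAffine.coord (.inr i)).mul_const ((cellCount K : ℝ) ^ (i : ℕ)), fun x _ => ?_⟩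
    simp [cellCode]

/-! ### Taylor polynomials on a box -/

section Taylor

variable {ι : Type*} [Fintype ι] [DecidableEq ι]

/-- The homogeneous part of degree `j` of the Taylor polynomial of `∂^α f`, times `j!`, where `c γ`
stands for the value of `∂^γ f` at the base point. -/
def taylorForm (c : (ι → ℕ) → ℝ) : ℕ → (ι → ℕ) → (ι → ℝ) → ℝ
  | 0, α, _ => c α
  | j + 1, α, h => ∑ i, h i * taylorForm c j (α + Pi.single i 1) h

/-- The Taylor polynomial of degree `n` of `∂^α f`, where `c γ` stands for the value of `∂^γ f` at
the base point. -/
noncomputable def taylorPoly (c : (ι → ℕ) → ℝ) (n : ℕ) (α : ι → ℕ) (h : ι → ℝ) : ℝ :=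
  ∑ j ∈ Finset.range (n + 1), taylorForm c j α h / j.factorial

variable {c : (ι → ℕ) → ℝ} {n : ℕ} {α : ι → ℕ} {h : ι → ℝ} {i : ι} {t : ℝ}

theorem taylorForm_eq_sum (j : ℕ) : taylorForm c j α h =
    ∑ i : Fin j → ι, ((List.ofFn i).map h).prod * c (α + ∑ k, Pi.single (i k) 1) := by
  induction j generalizing α with
  | zero => simp [taylorForm]
  | succ j ih =>
    rw [← (Fin.consEquiv fun _ => ι).sum_comp, Fintype.sum_prod_type, taylorForm]
    simp [ih, Finset.mul_sum, Fin.consEquiv, List.ofFn_succ, Fin.sum_univ_succ, mul_assoc,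
      add_assoc]

theorem taylorPoly_zero_right : taylorPoly c n α 0 = c α := by
  simp [taylorPoly, Finset.sum_range_succ', taylorForm]

theorem hasDerivAt_taylorForm (j : ℕ) :
    HasDerivAt (fun t => taylorForm c j α (Function.update h i t))
      (j * taylorForm c (j - 1) (α + Pi.single i 1) (Function.update h i t)) t := by
  induction j generalizing α with
  | zero => simpa only [taylorForm, Nat.cast_zero, zero_mul] using hasDerivAt_const t (c α)
  | succ j ih =>
    have hsum := HasDerivAt.fun_sum (u := Finset.univ) fun k _ =>
      (hasDerivAt_pi.mp (hasDerivAt_update h i t) k).mul (ih (α := α + Pi.single k 1))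
    refine hsum.congr_deriv ?_
    simp only [Finset.sum_add_distrib, Pi.single_apply, ite_mul, one_mul, zero_mul,
      Finset.sum_ite_eq', Finset.mem_univ, if_true, Nat.add_sub_cancel]
    rcases j with _ | j
    · simp
    · simp only [Nat.add_sub_cancel, taylorForm, Finset.mul_sum, add_right_comm α, Nat.cast_add,
        Nat.cast_one, add_mul, one_mul, mul_add, mul_left_comm, Finset.sum_add_distrib]
      ring

theorem hasDerivAt_taylorPoly :
    HasDerivAt (fun t => taylorPoly c (n + 1) α (Function.update h i t))
      (taylorPoly c n (α + Pi.single i 1) (Function.update h i t)) t := by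
  have hsum := HasDerivAt.fun_sum (u := Finset.range (n + 2)) fun j _ =>
    (hasDerivAt_taylorForm (c := c) (α := α) (h := h) (i := i) (t := t) j).div_const j.factorial
  refine hsum.congr_deriv ?_
  rw [Finset.sum_range_succ', taylorPoly]
  simp only [Nat.cast_zero, zero_mul, zero_div, add_zero, Nat.add_sub_cancel, Nat.factorial_succ]
  refine Finset.sum_congr rfl fun j _ => ?_
  push_cast
  field

variable {l u : ι → ℝ}

theorem abs_sub_le_mul_sum_of_hasDerivWithinAt {E : (ι → ℝ) → ℝ} {G : ι → (ι → ℝ) → ℝ} {C : ℝ}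
    (hE : ∀ i, ∀ z ∈ Set.Icc l u, HasDerivWithinAt (fun t => E (Function.update z i t)) (G i z)
      (Set.Icc (l i) (u i)) (z i))
    (hG : ∀ i, ∀ z ∈ Set.Icc l u, |G i z| ≤ C) {x y : ι → ℝ} (hx : x ∈ Set.Icc l u)
    (hy : y ∈ Set.Icc l u) : |E x - E y| ≤ C * ∑ i, |x i - y i| := by
  have hupdate {z : ι → ℝ} (hz : z ∈ Set.Icc l u) {i : ι} {t : ℝ}
      (ht : t ∈ Set.Icc (l i) (u i)) : Function.update z i t ∈ Set.Icc l u :=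
    ⟨le_update_iff.mpr ⟨ht.1, fun j _ => hz.1 j⟩, update_le_iff.mpr ⟨ht.2, fun j _ => hz.2 j⟩⟩
  have hcoord {z : ι → ℝ} (hz : z ∈ Set.Icc l u) {i : ι} {t : ℝ} (ht : t ∈ Set.Icc (l i) (u i)) :
      |E (Function.update z i t) - E z| ≤ C * |t - z i| := by
    have hderiv : ∀ t ∈ Set.Icc (l i) (u i), HasDerivWithinAt
        (fun t => E (Function.update z i t)) (G i (Function.update z i t))
        (Set.Icc (l i) (u i)) t := fun t ht => by
      simpa using hE i _ (hupdate hz ht)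
    simpa using (convex_Icc _ _).norm_image_sub_le_of_norm_hasDerivWithin_le hderiv
      (fun t ht => hG i _ (hupdate hz ht)) ⟨hz.1 i, hz.2 i⟩ ht
  have hpiecewise (s : Finset ι) : |E (s.piecewise x y) - E y| ≤ C * ∑ i ∈ s, |x i - y i| := by
    induction s using Finset.induction_on with
    | empty => simp
    | insert i s his ih =>
      have hstep := hcoord (Finset.piecewise_mem_Icc_of_mem_of_mem s hx hy)
        (i := i) ⟨hx.1 i, hx.2 i⟩
      rw [Finset.piecewise_eq_of_notMem _ _ _ his] at hstep
      rw [Finset.piecewise_insert, Finset.sum_insert his, mul_add]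
      exact (abs_sub_le _ _ _).trans (add_le_add hstep ih)
  simpa using hpiecewise Finset.univ

/-- `T α` is the partial derivative `∂^α` of `T 0` on the box `[l, u]`, for `|α| ≤ s`; on the faces
of the box, derivatives are one-sided. -/
def IsPartialDerivFamily (s : ℕ) (l u : ι → ℝ) (T : (ι → ℕ) → (ι → ℝ) → ℝ) : Prop :=
  ∀ α : ι → ℕ, ∑ j, α j < s → ∀ i, ∀ z ∈ Set.Icc l u, HasDerivWithinAt
    (fun t => T α (Function.update z i t)) (T (α + Pi.single i 1) z) (Set.Icc (l i) (u i)) (z i)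

namespace IsPartialDerivFamily

variable {s : ℕ} {T : (ι → ℕ) → (ι → ℝ) → ℝ}

theorem mono (hT : IsPartialDerivFamily s l u T) {l' u' : ι → ℝ} (hl : l ≤ l') (hu : u' ≤ u) :
    IsPartialDerivFamily s l' u' T := fun α hα i z hz =>
  (hT α hα i z (Set.Icc_subset_Icc hl hu hz)).mono (Set.Icc_subset_Icc (hl i) (hu i))

theorem abs_sub_taylorPoly_le (hT : IsPartialDerivFamily s l u T) {y : ι → ℝ}
    (hy : y ∈ Set.Icc l u) {ρ H : ℝ} (hρ : ∀ x ∈ Set.Icc l u, ∑ i, |x i - y i| ≤ ρ) (hH0 : 0 ≤ H)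
    (hH : ∀ α : ι → ℕ, ∑ j, α j = s → ∀ x ∈ Set.Icc l u, |T α x - T α y| ≤ H)
    (hα : ∑ j, α j + n = s) {x : ι → ℝ} (hx : x ∈ Set.Icc l u) :
    |T α x - taylorPoly (fun α => T α y) n α (x - y)| ≤ ρ ^ n * H := by
  induction n generalizing α x with
  | zero => simpa [taylorPoly, taylorForm] using hH α (by simpa using hα) x hx
  | succ n ih =>
    have hρ0 : 0 ≤ ρ := (Finset.sum_nonneg fun i _ => abs_nonneg _).trans (hρ x hx)
    have hsum (i : ι) : ∑ j, (α + Pi.single i 1 : ι → ℕ) j + n = s := by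
      simp [Finset.sum_add_distrib, ← hα]
      ring
    have hderiv (i : ι) (z : ι → ℝ) (hz : z ∈ Set.Icc l u) : HasDerivWithinAt
        (fun t => T α (Function.update z i t) -
          taylorPoly (fun α => T α y) (n + 1) α (Function.update z i t - y))
        (T (α + Pi.single i 1) z - taylorPoly (fun α => T α y) n (α + Pi.single i 1) (z - y))
        (Set.Icc (l i) (u i)) (z i) := by
      refine (hT α (by lia) i z hz).sub (HasDerivAt.hasDerivWithinAt ?_)
      have hshift (t : ℝ) : Function.update (z - y) i (t - y i) = Function.update z i t - y := by
        rw [Function.update_sub, Function.update_eq_self]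
      have hpoly := (hasDerivAt_taylorPoly (c := fun α => T α y) (n := n) (α := α) (h := z - y)
        (i := i)).comp_sub_const (z i) (y i)
      simpa only [hshift, Function.update_eq_self] using hpoly
    have hbound := abs_sub_le_mul_sum_of_hasDerivWithinAt
      (E := fun x => T α x - taylorPoly (fun α => T α y) (n + 1) α (x - y)) hderiv
      (fun i z hz => ih (hsum i) hz) hx hy
    rw [sub_self y, taylorPoly_zero_right, sub_self, sub_zero] at hbound
    calc _ ≤ ρ ^ n * H * ∑ i, |x i - y i| := hbound
      _ ≤ ρ ^ n * H * ρ := by gcongr; exact hρ x hx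
      _ = ρ ^ (n + 1) * H := by ring

end IsPartialDerivFamily

end Taylor

theorem norm_le_sqrt_mul_of_abs_le {d : ℕ} {z : EuclideanSpace ℝ (Fin d)} {a : ℝ} (ha : 0 ≤ a)
    (hz : ∀ i, |z i| ≤ a) : ‖z‖ ≤ √d * a := by
  rw [EuclideanSpace.norm_eq, Real.sqrt_le_left (by positivity), mul_pow,
    Real.sq_sqrt d.cast_nonneg]
  simpa using Finset.sum_le_card_nsmul Finset.univ _ _
    fun i _ => pow_le_pow_left₀ (abs_nonneg _) (hz i) 2

namespace HolderClass

variable {d s : ℕ} {r B₀ : ℝ} {f : EuclideanSpace ℝ (Fin d) → ℝ}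

theorem exists_isPartialDerivFamily (hf : HolderClass d s r B₀ f) :
    ∃ T : (Fin d → ℕ) → (Fin d → ℝ) → ℝ, IsPartialDerivFamily s 0 1 T ∧
      (∀ x ∈ Set.Icc 0 1, T 0 x = f (WithLp.toLp 2 x)) ∧
      (∀ α : Fin d → ℕ, ∑ j, α j ≤ s → ∀ x ∈ Set.Icc 0 1, |T α x| ≤ B₀) ∧
      ∀ α : Fin d → ℕ, ∑ j, α j = s → ∀ x ∈ Set.Icc 0 1, ∀ y ∈ Set.Icc 0 1,
        |T α x - T α y| ≤ B₀ * ‖WithLp.toLp 2 (x - y)‖ ^ r := by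
  obtain ⟨D, hD0, hD, hDb, hDs⟩ := hf
  have hcube {x : Fin d → ℝ} (hx : x ∈ Set.Icc 0 1) : WithLp.toLp 2 x ∈ unitCube d :=
    fun i => ⟨hx.1 i, hx.2 i⟩
  refine ⟨fun α x => D α (WithLp.toLp 2 x), fun α hα i z hz => ?_, fun x hx => hD0 _ (hcube hx),
    fun α hα x hx => hDb α hα _ (hcube hx), fun α hα x hx y hy =>
      hDs α hα _ (hcube hx) _ (hcube hy)⟩
  have hline (t : ℝ) : WithLp.toLp 2 z + (t - z i) • EuclideanSpace.single i (1 : ℝ) =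
      WithLp.toLp 2 (Function.update z i t) := by
    ext k
    rcases eq_or_ne k i with rfl | hk <;> simp [*]
  have hmaps : Set.MapsTo (fun t => t - z i) (Set.Icc 0 1)
      ((fun t : ℝ => WithLp.toLp 2 z + t • EuclideanSpace.single i (1 : ℝ)) ⁻¹' unitCube d) := by
    intro t ht
    rw [Set.mem_preimage, hline]
    exact hcube ⟨le_update_iff.mpr ⟨ht.1, fun j _ => hz.1 j⟩,
      update_le_iff.mpr ⟨ht.2, fun j _ => hz.2 j⟩⟩
  have hcomp := HasDerivWithinAt.comp_of_eq (z i) (hD α hα i _ (hcube hz))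
    ((hasDerivWithinAt_id (z i) _).sub_const (z i)) hmaps (sub_self _).symm
  simpa only [Function.comp_def, hline, mul_one, id_eq] using! hcomp

theorem abs_le (hf : HolderClass d s r B₀ f) {x : EuclideanSpace ℝ (Fin d)} (hx : x ∈ unitCube d) :
    |f x| ≤ B₀ := by
  obtain ⟨D, hD0, -, hDb, -⟩ := hf
  rw [← hD0 x hx]
  exact hDb 0 (by simp) x hx

theorem exists_abs_sub_taylorPoly_le (hf : HolderClass d s r B₀ f) (hr : 0 ≤ r) :
    ∃ T : (Fin d → ℕ) → (Fin d → ℝ) → ℝ,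
      (∀ α : Fin d → ℕ, ∑ j, α j ≤ s → ∀ x ∈ Set.Icc 0 1, |T α x| ≤ B₀) ∧
      ∀ a : ℝ, 0 ≤ a → ∀ x ∈ Set.Icc 0 1, ∀ y ∈ Set.Icc 0 1, (∀ i, |x i - y i| ≤ a) →
        |f (WithLp.toLp 2 x) - taylorPoly (fun α => T α y) s 0 (x - y)| ≤
          (d * a) ^ s * (B₀ * (√d * a) ^ r) := by
  obtain ⟨T, hT, hT0, hTb, hTs⟩ := hf.exists_isPartialDerivFamily
  refine ⟨T, hTb, fun a ha x hx y hy hxy => ?_⟩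
  have hB₀ : 0 ≤ B₀ := (abs_nonneg _).trans (hTb 0 (by simp) x hx)
  have hbox : Set.uIcc y x ⊆ Set.Icc 0 1 := Set.uIcc_subset_Icc hy hx
  have hclose {z : Fin d → ℝ} (hz : z ∈ Set.uIcc y x) (i : Fin d) : |z i - y i| ≤ a :=
    (Set.abs_sub_left_of_mem_uIcc ⟨hz.1 i, hz.2 i⟩).trans (hxy i)
  rw [← hT0 x hx]
  refine (hT.mono (le_inf hy.1 hx.1) (sup_le hy.2 hx.2)).abs_sub_taylorPoly_le
    Set.left_mem_uIcc (fun z hz => ?_) (by positivity) (fun α hα z hz => ?_) (by simp)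
    Set.right_mem_uIcc
  · simpa using Finset.sum_le_card_nsmul Finset.univ _ _ fun i _ => hclose hz i
  · refine (hTs α hα z (hbox hz) y hy).trans ?_
    gcongr
    exact norm_le_sqrt_mul_of_abs_le ha (hclose hz)

end HolderClass

/-! ### The approximating network -/

/-- Bases of a positional system with at least `(N * M) ^ k` values, all of size at most
`max N 2`, of which there are only about `k * log₂ M`. -/
def digitBases (N M k : ℕ) : List ℕ :=
  List.replicate k N ++ List.replicate (k * Nat.clog 2 M) 2

theorem length_digitBases (N M k : ℕ) : (digitBases N M k).length = k * (1 + Nat.clog 2 M) := by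
  rw [digitBases, List.length_append, List.length_replicate, List.length_replicate]
  ring

theorem pow_le_prod_digitBases (N M k : ℕ) : (N * M) ^ k ≤ (digitBases N M k).prod := by
  rw [digitBases, List.prod_append, List.prod_replicate, List.prod_replicate, mul_comm k, pow_mul,
    ← mul_pow]
  gcongr
  exact Nat.le_pow_clog one_lt_two M

theorem one_le_and_le_of_mem_digitBases {N M k b : ℕ} (hN : 1 ≤ N) (hb : b ∈ digitBases N M k) :
    1 ≤ b ∧ b ≤ 2 * N := by
  grind [digitBases]

/-- The terms of the Taylor polynomial of degree `s`: the tuple `i` of length `j` stands for the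
partial derivative `∂_{i 0} ⋯ ∂_{i (j - 1)}`. -/
abbrev TaylorIndex (d s : ℕ) : Type := Σ j : Fin (s + 1), Fin j → Fin d

namespace TaylorIndex

variable {d s : ℕ}

/-- The multi-index `α` for which `∂^α` is the partial derivative that `t` stands for. -/
def multiIndex (t : TaylorIndex d s) : Fin d → ℕ := ∑ k, Pi.single (t.2 k) 1

theorem sum_multiIndex (t : TaylorIndex d s) : ∑ j, t.multiIndex j = t.1 := by
  simp only [multiIndex, Finset.sum_apply]
  rw [Finset.sum_comm]
  simp

theorem card_le (hd : 1 ≤ d) : Fintype.card (TaylorIndex d s) ≤ (s + 1) * d ^ s := by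
  rw [Fintype.card_sigma]
  refine (Finset.sum_le_card_nsmul _ _ (d ^ s) fun j _ => ?_).trans (by simp)
  simpa using Nat.pow_le_pow_right hd (Nat.lt_succ_iff.mp j.2)

end TaylorIndex

theorem taylorPoly_eq_sum_taylorIndex {d s : ℕ} (c : (Fin d → ℕ) → ℝ) (h : Fin d → ℝ) :
    taylorPoly c s 0 h = ∑ t : TaylorIndex d s,
      ((List.ofFn t.2).map h).prod * c t.multiIndex / (t.1 : ℕ).factorial := by
  rw [taylorPoly, Finset.sum_range, Fintype.sum_sigma]
  simp [taylorForm_eq_sum, Finset.sum_div, TaylorIndex.multiIndex]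

theorem abs_div_factorial_mul_sub_le {B Q c p : ℝ} (hB : 0 < B) (hQ : 0 ≤ Q) {j : ℕ}
    (h : |c - p / B| ≤ (j + 2) / Q) :
    |B / j.factorial * c - p / j.factorial| ≤ B * (3 / Q) := by
  have hfact : (j : ℝ) + 2 ≤ 3 * j.factorial := by
    have := Nat.self_le_factorial j
    have := Nat.factorial_pos j
    exact_mod_cast (by lia : j + 2 ≤ 3 * j.factorial)
  have heq : B / j.factorial * c - p / j.factorial = B / j.factorial * (c - p / B) := by field
  rw [heq, abs_mul, abs_of_nonneg (by positivity)]
  calc B / j.factorial * |c - p / B| ≤ B / j.factorial * (3 * j.factorial / Q) := by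
        gcongr
        exact h.trans (by gcongr)
    _ = B * (3 / Q) := by field

namespace Computes

variable {d K N M s : ℕ} [NeZero N] [NeZero M] {δ : ℝ} {S : Set (Fin d → ℝ)}
  {V : (Fin d → ℝ) → ℝ}

theorem exists_approx_at_center (hd : 1 ≤ d) (hK : 1 ≤ K) (hδ : 0 < δ) (hδK : δ * K < 2)
    (hS : ∀ x ∈ S, ∀ i, x i ∈ safeInterval K δ) (hcard : cellCount K ^ d ≤ (N * M) ^ 2)
    (hV : ∀ y ∈ Set.Icc 0 1, |V y| ≤ 1) (k : ℕ) :
    ∃ v : (Fin d → ℝ) → ℝ,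
      Computes S (38 * d * N)
        (1 + 2 * (1 + Nat.clog 2 M) + (M * (2 + k * (1 + Nat.clog 2 M)) + M + 3))
        (fun x => Sum.elim (fun i => x i - centerOfCode K (cellCode K δ x) i)
          (fun _ : Unit => v x)) ∧
      ∀ x ∈ S, |v x| ≤ 1 ∧
        |v x - V (centerOfCode K (cellCode K δ x))| ≤ 2 / ((N : ℝ) * M) ^ k := by
  have hN : 1 ≤ N := NeZero.one_le
  have hdN : 1 * N ≤ d * N := Nat.mul_le_mul_right N hd
  have hdN' : d * 1 ≤ d * N := Nat.mul_le_mul_left d hN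
  have hcell := sub_center_cellCode (B := 2 * N) (w := 38 * d * N) hK hδ hδK hS
    (fun b => one_le_and_le_of_mem_digitBases hN)
    ((Nat.le_self_pow (by lia) _).trans (hcard.trans (pow_le_prod_digitBases N M 2)))
    (by rw [mul_assoc]; lia)
  obtain ⟨out, hout, hspec⟩ := hcell.exists_lookup (ξ := fun n => (V (centerOfCode K n) + 1) / 2)
    (fun b => one_le_and_le_of_mem_digitBases (M := M) (k := k) hN)
    (fun n => by
      have := abs_le.mp (hV _ (centerOfCode_mem_Icc hK n))
      constructor <;> linarith)
    (fun x _ => (cellCode_lt hK hδ x).trans_le hcard)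
    (by rw [Fintype.card_fin, mul_assoc]; lia)
  refine ⟨fun x => 2 * out x - 1, ?_, fun x hx => ?_⟩
  · rw [length_digitBases, length_digitBases] at hout
    exact hout.affine_inr fun _ =>
      ⟨_, ((IsAffine.coord (.inr ())).const_mul 2).sub (.const 1), fun x _ => rfl⟩
  · obtain ⟨⟨h0, h1⟩, hξ⟩ := hspec x hx
    refine ⟨abs_le.mpr ⟨by linarith, by linarith⟩, ?_⟩
    set y := centerOfCode K (cellCode K δ x)
    have hprod : ((N : ℝ) * M) ^ k ≤ (digitBases N M k).prod := by
      exact_mod_cast pow_le_prod_digitBases N M k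
    calc |2 * out x - 1 - V y| = 2 * |out x - (V y + 1) / 2| := by
          rw [← abs_two (α := ℝ), ← abs_mul, abs_two]
          congr 1
          ring
      _ ≤ 2 * (1 / (digitBases N M k).prod) := by gcongr
      _ ≤ 2 / ((N : ℝ) * M) ^ k := by
          rw [mul_one_div]
          have := NeZero.pos N
          have := NeZero.pos M
          gcongr

theorem depth_taylorTerm_le {a p j : ℕ} (hp : 1 ≤ p) (hj : j < a) :
    1 + 2 * p + (M * (2 + 2 * a * p) + M + 3) + j * (a * p) ≤ 21 * a ^ 2 * M * p := by
  have hM : 1 ≤ M := NeZero.one_le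
  have haa : a ≤ a ^ 2 := Nat.le_self_pow two_ne_zero a
  have ha : 1 ≤ a ^ 2 := (Nat.one_le_of_lt hj).trans haa
  have h1 : 1 * 1 * 1 ≤ M * p * a ^ 2 := by gcongr
  have hM' : M * 1 * 1 ≤ M * p * a ^ 2 := by gcongr
  have hp' : 1 * p * 1 ≤ M * p * a ^ 2 := by gcongr
  have hap : M * p * a ≤ M * p * a ^ 2 := by gcongr
  have hja : 1 * p * (j * a) ≤ M * p * a ^ 2 := by
    rw [pow_two]
    gcongr
  linarith

theorem exists_approx_taylorTerm (hd : 1 ≤ d) (hK : 2 ≤ K) (hδ : 0 < δ) (hδK : δ * K < 2)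
    (hS : ∀ x ∈ S, ∀ i, x i ∈ safeInterval K δ) (hNM : 2 ≤ N * M)
    (hcard : cellCount K ^ d ≤ (N * M) ^ 2) (hV : ∀ y ∈ Set.Icc 0 1, |V y| ≤ 1)
    {l : List (Fin d)} (hl : l.length ≤ s) :
    ∃ c : (Fin d → ℝ) → ℝ,
      Computes S (38 * d * N) (21 * (s + 1) ^ 2 * M * (1 + Nat.clog 2 M))
        (fun x (_ : Unit) => c x) ∧
      ∀ x ∈ S, |c x - (l.map (x - centerOfCode K (cellCode K δ x))).prod *
          V (centerOfCode K (cellCode K δ x))| ≤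
        (l.length + 2) / ((N : ℝ) * M) ^ (2 * (s + 1)) := by
  have hN : 1 ≤ N := NeZero.one_le
  have hdN : 1 * N ≤ d * N := Nat.mul_le_mul_right N hd
  have hdN' : d * 1 ≤ d * N := Nat.mul_le_mul_left d hN
  obtain ⟨v, hv, hspec⟩ := exists_approx_at_center hd (by lia) hδ hδK hS hcard hV (2 * (s + 1))
  set bs := digitBases N M (s + 1) with hbs_def
  have hbs : ∀ b ∈ bs, 1 ≤ b ∧ b ≤ 2 * N := fun b => one_le_and_le_of_mem_digitBases hN
  have hprod : (N * M) ^ (s + 1) ≤ bs.prod := pow_le_prod_digitBases N M (s + 1)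
  refine ⟨_, ((hv.foldl_mulApprox (by rw [Fintype.card_fin, mul_assoc]; lia) hbs l).affine
    fun _ => ⟨_, .coord (.inr ()), fun x _ => rfl⟩).mono_depth ?_ ?_, fun x hx => ?_⟩
  · rw [Fintype.card_unit, mul_assoc]
    lia
  · rw [hbs_def, length_digitBases]
    exact depth_taylorTerm_le (by lia) (by lia)
  · obtain ⟨hv1, hvV⟩ := hspec x hx
    set y := centerOfCode K (cellCode K δ x) with hy
    have hclose : ∀ a ∈ l.map (x - y), |a| ≤ 1 / 2 := List.forall_mem_map.mpr fun i _ => by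
      rw [hy, centerOfCode_cellCode (by lia) hδ]
      refine (abs_sub_cellCenter_le (by lia) hδK (hS x hx i).1).trans ?_
      gcongr
      exact_mod_cast hK
    have hmul := abs_foldl_mulApprox_sub_le (fun b hb => (hbs b hb).1)
      ((hNM.trans (Nat.le_self_pow (by lia) _)).trans hprod) hv1 hclose
    have hP := abs_list_prod_le_one fun a ha => (hclose a ha).trans (by norm_num)
    have := NeZero.pos N
    have := NeZero.pos M
    refine (abs_sub_le _ (v x * (l.map (x - y)).prod) _).trans ?_
    rw [add_div, mul_comm _ (V y), ← sub_mul, abs_mul]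
    refine add_le_add (hmul.trans ?_) ((mul_le_of_le_one_right (abs_nonneg _) hP).trans hvV)
    rw [List.length_map, mul_comm 2, pow_mul]
    gcongr
    exact_mod_cast hprod

theorem exists_approx_taylorPoly (hd : 1 ≤ d) (hK : 2 ≤ K) (hδ : 0 < δ) (hδK : δ * K < 2)
    (hS : ∀ x ∈ S, ∀ i, x i ∈ safeInterval K δ) (hNM : 2 ≤ N * M)
    (hcard : cellCount K ^ d ≤ (N * M) ^ 2) {B₀ : ℝ} (hB₀ : 0 < B₀)
    {T : (Fin d → ℕ) → (Fin d → ℝ) → ℝ}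
    (hT : ∀ α : Fin d → ℕ, ∑ j, α j ≤ s → ∀ y ∈ Set.Icc 0 1, |T α y| ≤ B₀) :
    ∃ c : (Fin d → ℝ) → ℝ,
      Computes S ((s + 1) * d ^ s * (38 * d * N)) (21 * (s + 1) ^ 2 * M * (1 + Nat.clog 2 M))
        (fun x (_ : Unit) => c x) ∧
      ∀ x ∈ S, |c x - taylorPoly (fun α => T α (centerOfCode K (cellCode K δ x))) s 0
          (x - centerOfCode K (cellCode K δ x))| ≤
        (s + 1) * d ^ s * (B₀ * (3 / ((N : ℝ) * M) ^ (2 * (s + 1)))) := by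
  have hscale (t : TaylorIndex d s) : ∀ y ∈ Set.Icc 0 1, |T t.multiIndex y / B₀| ≤ 1 :=
    fun y hy => by
      rw [abs_div, abs_of_pos hB₀, div_le_one hB₀]
      exact hT _ (t.sum_multiIndex.trans_le (Nat.lt_succ_iff.mp t.1.2)) y hy
  choose c hc hspec using fun t : TaylorIndex d s =>
    exists_approx_taylorTerm hd hK hδ hδK hS hNM hcard (hscale t) (l := List.ofFn t.2)
      (List.length_ofFn.trans_le (Nat.lt_succ_iff.mp t.1.2))
  refine ⟨fun x => ∑ t, B₀ / (t.1 : ℕ).factorial * c t x,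
    (Computes.sum Finset.univ fun t => (hc t).affine fun _ =>
      ⟨_, (IsAffine.coord ()).const_mul (B₀ / (t.1 : ℕ).factorial), fun x _ => rfl⟩).mono_width
      (Nat.mul_le_mul_right _ (TaylorIndex.card_le hd)), fun x hx => ?_⟩
  set y := centerOfCode K (cellCode K δ x)
  set Q := ((N : ℝ) * M) ^ (2 * (s + 1))
  have hterm (t : TaylorIndex d s) : |B₀ / (t.1 : ℕ).factorial * c t x -
      ((List.ofFn t.2).map (x - y)).prod * T t.multiIndex y / (t.1 : ℕ).factorial| ≤
        B₀ * (3 / Q) := by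
    have h := hspec t x hx
    rw [List.length_ofFn, ← mul_div_assoc] at h
    exact abs_div_factorial_mul_sub_le hB₀ (by positivity) h
  rw [taylorPoly_eq_sum_taylorIndex, ← Finset.sum_sub_distrib]
  calc _ ≤ ∑ _t : TaylorIndex d s, B₀ * (3 / Q) :=
        (Finset.abs_sum_le_sum_abs _ _).trans (Finset.sum_le_sum fun t _ => hterm t)
    _ = Fintype.card (TaylorIndex d s) * (B₀ * (3 / Q)) := by
        rw [Finset.sum_const, Finset.card_univ, nsmul_eq_mul]
    _ ≤ (s + 1) * d ^ s * (B₀ * (3 / Q)) := by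
        gcongr
        exact_mod_cast TaylorIndex.card_le hd

end Computes

/-! ### The approximation error -/

theorem cellCount_pow_le {d N M K : ℕ} (hd : 1 ≤ d) (hN : 1 ≤ N) (hM : 1 ≤ M)
    (hK : K = ⌈((M : ℝ) * N) ^ ((2 : ℝ) / d)⌉₊) : cellCount K ^ d ≤ (N * M) ^ 2 := by
  have hMN : (1 : ℝ) ≤ (M : ℝ) * N := by exact_mod_cast Nat.mul_pos hM hN
  set L := ((M : ℝ) * N) ^ ((2 : ℝ) / d) with hL
  have hL1 : 1 ≤ L := Real.one_le_rpow hMN (by positivity)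
  have hKL : (K : ℝ) < L + 1 := hK ▸ Nat.ceil_lt_add_one (by linarith)
  have hcount : (cellCount K : ℝ) ≤ L := by
    rcases le_or_gt K 2 with h | h
    · have : (cellCount K : ℝ) ≤ 1 := by exact_mod_cast (by grind [cellCount] : cellCount K ≤ 1)
      linarith
    · have : (cellCount K : ℝ) + 1 ≤ K := by
        exact_mod_cast (by grind [cellCount] : cellCount K + 1 ≤ K)
      linarith
  have hLd : L ^ d = ((N : ℝ) * M) ^ 2 := by
    rw [hL, ← Real.rpow_mul_natCast (by linarith), div_mul_cancel₀ _ (by positivity),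
      Real.rpow_two, mul_comm (M : ℝ)]
  have hpow : (cellCount K : ℝ) ^ d ≤ L ^ d := by gcongr
  rw [hLd] at hpow
  exact_mod_cast hpow

theorem one_add_clog_le_ceil_logb {M : ℕ} (hM : 1 ≤ M) :
    1 + Nat.clog 2 M ≤ ⌈Real.logb 2 (8 * (M : ℝ))⌉₊ := by
  have hceil := Real.natCeil_logb_natCast 2 (8 * M)
  push_cast at hceil
  rw [hceil, add_comm, Nat.clog_of_two_le (n := 8 * M) one_lt_two (by lia)]
  gcongr
  lia

theorem mul_width_taylorTerm_le (d s N : ℕ) {l : ℕ} (hl : 1 ≤ l) :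
    (s + 1) * d ^ s * (38 * d * N) ≤ 38 * (s + 1) ^ 2 * d ^ (s + 1) * N * l :=
  calc (s + 1) * d ^ s * (38 * d * N) = 38 * (s + 1) * d ^ (s + 1) * N * 1 := by ring
    _ ≤ 38 * (s + 1) ^ 2 * d ^ (s + 1) * N * l := by
      gcongr
      exact Nat.le_self_pow two_ne_zero _

theorem holder_remainder_le {d s : ℕ} {r β X κ : ℝ} (hd : 1 ≤ d) (hr : 0 < r) (hβ : β = s + r)
    (hX : 1 ≤ X) (hκ : X ^ ((2 : ℝ) / d) ≤ κ) :
    (d * (1 / κ)) ^ s * (√d * (1 / κ)) ^ r ≤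
      (d : ℝ) ^ ((s : ℝ) + max β 1 / 2) * X ^ (-2 * β / d) := by
  have hd1 : (1 : ℝ) ≤ d := by exact_mod_cast hd
  have hX0 : 0 < X := by linarith
  have hκ0 : 0 < κ := (Real.rpow_pos_of_pos hX0 _).trans_le hκ
  have hexp : (s : ℝ) + r / 2 ≤ s + max β 1 / 2 := by
    have := le_max_left β 1
    linarith [(s.cast_nonneg : (0 : ℝ) ≤ s)]
  have hκβ : (1 / κ) ^ β ≤ X ^ (-2 * β / d) := by
    have hβ0 : 0 ≤ β := by rw [hβ]; positivity
    calc (1 / κ) ^ β ≤ (1 / X ^ ((2 : ℝ) / d)) ^ β := by gcongr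
      _ = X ^ (-2 * β / d) := by
        rw [one_div, ← Real.rpow_neg hX0.le, ← Real.rpow_mul hX0.le]
        congr 1
        ring
  calc (d * (1 / κ)) ^ s * (√d * (1 / κ)) ^ r = (d : ℝ) ^ ((s : ℝ) + r / 2) * (1 / κ) ^ β := by
        rw [hβ, Real.rpow_add (by positivity), Real.rpow_add (by positivity), Real.rpow_natCast,
          Real.rpow_natCast, mul_pow, Real.mul_rpow (by positivity) (by positivity),
          Real.sqrt_eq_rpow, ← Real.rpow_mul d.cast_nonneg, one_div_mul_eq_div]
        ring
    _ ≤ _ := by gcongr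

theorem one_div_pow_le_rpow {d s : ℕ} {r β X : ℝ} (hd : 1 ≤ d) (hr : r ≤ 1) (hβ : β = s + r)
    (hX : 1 ≤ X) : 1 / X ^ (2 * (s + 1)) ≤ X ^ (-2 * β / d) := by
  have hd1 : (1 : ℝ) ≤ d := by exact_mod_cast hd
  rw [one_div, ← Real.rpow_natCast, ← Real.rpow_neg (by linarith)]
  have hβd : β / d ≤ s + 1 := by
    rw [div_le_iff₀ (by linarith), hβ]
    exact (add_le_add_right hr _).trans (le_mul_of_one_le_right (by positivity) hd1)
  refine Real.rpow_le_rpow_of_exponent_le hX ?_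
  rw [mul_div_assoc]
  push_cast
  linarith

theorem approximation_error_le {d s : ℕ} {r β B₀ X κ : ℝ} (hd : 1 ≤ d) (hr0 : 0 < r) (hr1 : r ≤ 1)
    (hβ : β = s + r) (hB₀ : 0 ≤ B₀) (hX : 1 ≤ X) (hκ : X ^ ((2 : ℝ) / d) ≤ κ) :
    (d * (1 / κ)) ^ s * (B₀ * (√d * (1 / κ)) ^ r) +
      (s + 1) * d ^ s * (B₀ * (3 / X ^ (2 * (s + 1)))) ≤
    18 * B₀ * ((s : ℝ) + 1) ^ 2 * (d : ℝ) ^ ((s : ℝ) + max β 1 / 2) * X ^ (-2 * β / d) := by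
  have hholder := holder_remainder_le hd hr0 hβ hX hκ
  have hpow := one_div_pow_le_rpow hd hr1 hβ hX
  have hd1 : (1 : ℝ) ≤ d := by exact_mod_cast hd
  set Z := X ^ (-2 * β / d)
  have hds : (d : ℝ) ^ s ≤ (d : ℝ) ^ ((s : ℝ) + max β 1 / 2) := by
    rw [← Real.rpow_natCast]
    exact Real.rpow_le_rpow_of_exponent_le hd1 (le_add_of_nonneg_right (by positivity))
  set W := (d : ℝ) ^ ((s : ℝ) + max β 1 / 2)
  have : 0 ≤ Z := by positivity
  calc _ = B₀ * ((d * (1 / κ)) ^ s * (√d * (1 / κ)) ^ r) +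
        3 * (s + 1) * B₀ * (d ^ s * (1 / X ^ (2 * (s + 1)))) := by ring
    _ ≤ B₀ * (W * Z) + 3 * (s + 1) * B₀ * (W * Z) := by gcongr
    _ = (1 + 3 * (s + 1)) * (B₀ * (W * Z)) := by ring
    _ ≤ 18 * (s + 1) ^ 2 * (B₀ * (W * Z)) := by
        gcongr
        nlinarith [(s.cast_nonneg : (0 : ℝ) ≤ s)]
    _ = _ := by ring

namespace HolderClass

variable {d s : ℕ} {r B₀ : ℝ} {f : EuclideanSpace ℝ (Fin d) → ℝ}

theorem exists_computes (hf : HolderClass d s r B₀ f) (hd : 1 ≤ d) (hr : 0 ≤ r) (hB₀ : 0 < B₀)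
    {N M K : ℕ} [NeZero N] [NeZero M] (hNM : 2 ≤ N * M) (hK : 2 ≤ K)
    (hcard : cellCount K ^ d ≤ (N * M) ^ 2) {δ : ℝ} (hδ : 0 < δ) (hδK : δ * K < 2) :
    ∃ c : (Fin d → ℝ) → ℝ,
      Computes {x | ∀ i, x i ∈ safeInterval K δ} ((s + 1) * d ^ s * (38 * d * N))
        (21 * (s + 1) ^ 2 * M * (1 + Nat.clog 2 M)) (fun x (_ : Unit) => c x) ∧
      ∀ x : Fin d → ℝ, (∀ i, x i ∈ safeInterval K δ) → |f (WithLp.toLp 2 x) - c x| ≤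
        (d * (1 / K)) ^ s * (B₀ * (√d * (1 / K)) ^ r) +
          (s + 1) * d ^ s * (B₀ * (3 / ((N : ℝ) * M) ^ (2 * (s + 1)))) := by
  obtain ⟨T, hTb, hT⟩ := hf.exists_abs_sub_taylorPoly_le hr
  obtain ⟨c, hc, hcT⟩ := Computes.exists_approx_taylorPoly hd hK hδ hδK
    (S := {x | ∀ i, x i ∈ safeInterval K δ}) (fun x hx => hx) hNM hcard hB₀ hTb
  refine ⟨c, hc, fun x hx => ?_⟩
  have hcenter (i : Fin d) : |x i - centerOfCode K (cellCode K δ x) i| ≤ 1 / K := by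
    rw [centerOfCode_cellCode (by lia) hδ]
    exact abs_sub_cellCenter_le (by lia) hδK (hx i).1
  have htaylor := hT (1 / K) (by positivity) x ⟨fun i => (hx i).1.1, fun i => (hx i).1.2⟩
    _ (centerOfCode_mem_Icc (by lia) _) hcenter
  have hnet := hcT x hx
  rw [abs_sub_comm] at hnet
  exact (abs_sub_le _ _ _).trans (add_le_add htaylor hnet)

theorem exists_computes_le (hf : HolderClass d s r B₀ f) (hd : 1 ≤ d) {β : ℝ} (hr0 : 0 < r)
    (hr1 : r ≤ 1) (hβ : β = s + r) (hB₀ : 0 < B₀) {N M K : ℕ} (hN : 1 ≤ N) (hM : 1 ≤ M)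
    (hK : K = ⌈((M : ℝ) * N) ^ ((2 : ℝ) / d)⌉₊) {δ : ℝ} (hδ : 0 < δ) (hδK : δ * K < 2) :
    ∃ c : (Fin d → ℝ) → ℝ,
      Computes {x | ∀ i, x i ∈ safeInterval K δ} ((s + 1) * d ^ s * (38 * d * N))
        (21 * (s + 1) ^ 2 * M * (1 + Nat.clog 2 M)) (fun x (_ : Unit) => c x) ∧
      ∀ x : Fin d → ℝ, (∀ i, x i ∈ safeInterval K δ) → |f (WithLp.toLp 2 x) - c x| ≤
        18 * B₀ * ((s : ℝ) + 1) ^ 2 * (d : ℝ) ^ ((s : ℝ) + max β 1 / 2) *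
          ((N : ℝ) * M) ^ (-2 * β / d) := by
  rcases Nat.eq_or_lt_of_le (Nat.mul_pos hN hM) with hNM | hNM
  · refine ⟨fun _ => 0, .zero, fun x hx => ?_⟩
    have hNM' : (N : ℝ) * M = 1 := by exact_mod_cast hNM.symm
    have hd1 : (1 : ℝ) ≤ (d : ℝ) ^ ((s : ℝ) + max β 1 / 2) :=
      Real.one_le_rpow (by exact_mod_cast hd) (by positivity)
    have hs1 : (1 : ℝ) ≤ 18 * ((s : ℝ) + 1) ^ 2 := by
      nlinarith [(s.cast_nonneg : (0 : ℝ) ≤ s)]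
    rw [hNM', Real.one_rpow, sub_zero, mul_one, mul_comm 18, mul_assoc B₀, mul_assoc B₀]
    exact (hf.abs_le fun i => (hx i).1).trans
      (le_mul_of_one_le_right hB₀.le (one_le_mul_of_one_le_of_one_le hs1 hd1))
  · have hNM' : 1 < (N : ℝ) * M := by exact_mod_cast hNM
    have hKL : ((N : ℝ) * M) ^ ((2 : ℝ) / d) ≤ K := by
      rw [hK, mul_comm]
      exact Nat.le_ceil _
    have hK1 : (1 : ℝ) < K := (Real.one_lt_rpow hNM' (by positivity)).trans_le hKL
    have : NeZero N := ⟨by lia⟩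
    have : NeZero M := ⟨by lia⟩
    obtain ⟨c, hc, hcf⟩ := hf.exists_computes hd hr0.le hB₀ hNM (by exact_mod_cast hK1)
      (cellCount_pow_le hd hN hM hK) hδ hδK
    exact ⟨c, hc, fun x hx =>
      (hcf x hx).trans (approximation_error_le hd hr0 hr1 hβ hB₀.le hNM'.le hKL)⟩

end HolderClass

theorem mem_safeInterval_of_mem_unitCube_diff {d K : ℕ} {δ δ' : ℝ} (hδ : δ' ≤ δ)
    {x : EuclideanSpace ℝ (Fin d)} (hx : x ∈ unitCube d \ triflingRegion d K δ) (i : Fin d) :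
    x i ∈ safeInterval K δ' :=
  ⟨hx.1 i, fun k hk hkK h => hx.2 ⟨i, k, hk, hkK, (sub_le_sub_left hδ _).trans_lt h.1, h.2⟩⟩

theorem theorem3p1_general (d : ℕ) (hd : 1 ≤ d) (β : ℝ) (s : ℕ) (r : ℝ) (hr0 : 0 < r)
    (hr1 : r ≤ 1) (hβ : β = s + r) (B₀ : ℝ) (hB₀ : 0 < B₀)
    (f : EuclideanSpace ℝ (Fin d) → ℝ) (hf : HolderClass d s r B₀ f)
    (N M : ℕ) (hN : 1 ≤ N) (hM : 1 ≤ M)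
    (K : ℕ) (hK : K = ⌈((M : ℝ) * N) ^ ((2 : ℝ) / d)⌉₊)
    (δ : ℝ) (hδ0 : 0 < δ) :
    ∃ φ : ReLUNet d 1,
      φ.width = 38 * (s + 1) ^ 2 * d ^ (s + 1) * N * ⌈Real.logb 2 (8 * (N : ℝ))⌉₊ ∧
      φ.depth = 21 * (s + 1) ^ 2 * M * ⌈Real.logb 2 (8 * (M : ℝ))⌉₊ ∧
      ∀ x ∈ unitCube d \ triflingRegion d K δ,
        |f x - φ.eval (fun i => x i) 0| ≤
          18 * B₀ * ((s : ℝ) + 1) ^ 2 * (d : ℝ) ^ ((s : ℝ) + max β 1 / 2) *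
            ((N : ℝ) * M) ^ (-2 * β / d) := by
  have hlogN := one_add_clog_le_ceil_logb hN
  have hlogM := one_add_clog_le_ceil_logb hM
  have hK0 : (0 : ℝ) < K := by
    rw [hK, Nat.cast_pos, Nat.ceil_pos]
    positivity
  have hwidth := mul_width_taylorTerm_le d s N (l := ⌈Real.logb 2 (8 * (N : ℝ))⌉₊) (by lia)
  have hpos : 0 < (s + 1) * d ^ s * (d * N) := by positivity
  obtain ⟨c, hc, hcf⟩ := hf.exists_computes_le hd hr0 hr1 hβ hB₀ hN hM hK
    (δ := min δ (1 / K)) (by positivity)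
    (((le_div_iff₀ hK0).mp (min_le_right δ _)).trans_lt one_lt_two)
  have hnet := (hc.mono_depth (by rw [Fintype.card_unit]; nlinarith)
    (Nat.mul_le_mul_left _ hlogM)).mono_width hwidth
  obtain ⟨φ, hφwidth, hφdepth, hφ⟩ := (hnet.affine (F' := fun x (_ : Fin 1) => c x)
    fun _ => ⟨_, .coord (), fun _ _ => rfl⟩).exists_net
  refine ⟨φ, hφwidth.trans (if_neg ?_), hφdepth, fun x hx => ?_⟩
  · have : 0 < ⌈Real.logb 2 (8 * (M : ℝ))⌉₊ := by lia
    positivity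
  · have hxS := mem_safeInterval_of_mem_unitCube_diff (min_le_left δ (1 / K)) hx
    rw [hφ _ hxS]
    exact hcf _ hxS

theorem theorem3p1 (d : ℕ) (hd : 1 ≤ d) (β : ℝ) (s : ℕ) (r : ℝ) (hr0 : 0 < r) (hr1 : r ≤ 1)
    (hβ : β = s + r) (B₀ : ℝ) (hB₀ : 0 < B₀)
    (f : EuclideanSpace ℝ (Fin d) → ℝ) (hf : HolderClass d s r B₀ f)
    (N M : ℕ) (hN : 1 ≤ N) (hM : 1 ≤ M)
    (K : ℕ) (hK : K = ⌈((M : ℝ) * N) ^ ((2 : ℝ) / d)⌉₊)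
    (δ : ℝ) (hδ0 : 0 < δ) (hδ1 : δ ≤ 1 / (3 * (K : ℝ))) :
    ∃ φ : ReLUNet d 1,
      φ.width = 38 * (s + 1) ^ 2 * d ^ (s + 1) * N * ⌈Real.logb 2 (8 * (N : ℝ))⌉₊ ∧
      φ.depth = 21 * (s + 1) ^ 2 * M * ⌈Real.logb 2 (8 * (M : ℝ))⌉₊ ∧
      ∀ x ∈ unitCube d \ triflingRegion d K δ,
        |f x - φ.eval (fun i => x i) 0| ≤
          18 * B₀ * ((s : ℝ) + 1) ^ 2 * (d : ℝ) ^ ((s : ℝ) + max β 1 / 2) *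
            ((N : ℝ) * M) ^ (-2 * β / d) :=
  theorem3p1_general d hd β s r hr0 hr1 hβ B₀ hB₀ f hf N M hN hM K hK δ hδ0
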